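/- Notation. A vector is $s$-sparse if it has at most $s$ nonzero entries; $T_s$ is hard thresholding (keep $s$ entries of largest magnitude, ties broken arbitrarily, and set the others to $0$); $P_\Omega$ is the orthogonal projection of $\mathbb R^N$ onto $\operatorname{span}\{e_i : i\in\Omega\}$. The sub-Gaussian norm of a real random variable is $\|X\|_{\psi_2}=\inf\{t>0:\mathbb E\exp(X^2/t^2)\le 2\}$, that of a random vector $u$ is $\sup_{\|w\|_2=1}\|\langle w,u\rangle\|_{\psi_2}$, and $u$ is isotropic if $\mathbb E\,uu^T=I$. KZPT with period $m$, for an $m\times N$ matrix $A$ with rows $a_1^T,\dots,a_m^T$, data $b\in\mathbb R^m$, step sizes $\gamma,\lambda$ and permutations $\tau_1,\tau_2,\dots$ of $\{1,\dots,m\}$: $x^1_1=0$, and for $k\ge1$ $$x^k_{j+1}=x^k_j+\gamma\,\frac{b_{\tau_k(j)}-a_{\tau_k(j)}^Tx^k_j}{\|a_{\tau_k(j)}\|_2^2}\,a_{\tau_k(j)}\quad(1\le j\le m),\qquad x^{k+1}_1=T_s\bigl(x^k_1+\lambda(x^k_{m+1}-x^k_1)\bigr).$$ Theorem. There is an absolute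 constant $C_0>0$, and for all $K>0$ and $\rho\in(0,1)$ there are constants $C_1,C_2>0$ depending only on $K$ and $\rho$ (so only on $K$ if, say, $\rho=1/2$), such that the following holds. Let $m$, $N$ and $1\le s\le\rho N$ be integers, and let $A$ be a random $m\times N$ matrix whose rows $a_i$ are independent, mean-zero, isotropic, of sub-Gaussian norm at most $K$, with $\|a_i\|_2=\sqrt N$ almost surely. Let $$\delta=\sqrt{\frac{3s\ln(N/s)(K\ln m)^2}{m}}<\frac14,\qquad \gamma=\frac{\delta}{2m(K\ln m)^2N^{1/2}},\qquad \lambda=\frac{2N^{3/2}(K\ln m)^2}{\delta},$$ and suppose $m\ge C_1\,s\ln(N/s)(K\ln m)^2$. Then, with probability at least $1-(m^2+2)\exp(-C_2\ln^2m)$, for all $s$-sparse $x\in\mathbb R^N$, all $e\in\mathbb R^m$, all sequences $(\tau_k)$ of permutations of $\{1,\dots,m\}$ and all $k\ge0$ simultaneously, the iterates of KZPT with period $m$ applied to $b=Ax+e$ satisfy $$\|x^{k+1}_1-x\|_2\le(4\delta)^k\|x^1_1-x\|_2+\frac{2}{1-4\delta}\sup_{\Omega\subset\{1,\dots,N\},\,|\Omega|\le2s}\Bigl\|P_\Omega\Bigl(\frac1mA^Te\Bigr)\Bigr\|_2+C_0\sqrt{\frac{s\ln(N/s)}{m}}\;\frac{\|e\|_1}{(1-4\delta)m}.$$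 (In particular, the permutations, $x$ and $e$ may be random and may depend on $A$.) -/

import Mathlib

open MeasureTheory ProbabilityTheory
open scoped ENNReal Matrix

universe u

/-- The sub-Gaussian norm `inf {t > 0 : E exp (X² / t²) ≤ 2}` of a real random variable, with value
`∞` if there is no such `t`. -/
noncomputable def psiTwoNorm {Ω : Type u} [MeasurableSpace Ω] (μ : Measure Ω) (X : Ω → ℝ) : ℝ≥0∞ :=
  ⨅ (t : ℝ) (_ : 0 < t) (_ : ∫⁻ ω, ENNReal.ofReal (Real.exp (X ω ^ 2 / t ^ 2)) ∂μ ≤ 2),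
    ENNReal.ofReal t

/-- The sub-Gaussian norm of a random vector: the supremum of the sub-Gaussian norms of its
one-dimensional marginals in unit directions. -/
noncomputable def vecPsiTwoNorm {Ω : Type u} [MeasurableSpace Ω] (μ : Measure Ω) {N : ℕ}
    (v : Ω → EuclideanSpace ℝ (Fin N)) : ℝ≥0∞ :=
  ⨆ w ∈ Metric.sphere (0 : EuclideanSpace ℝ (Fin N)) 1, psiTwoNorm μ (fun ω => inner ℝ w (v ω))

/-- A random vector is isotropic if `E v vᵀ` is the identity matrix. -/
def IsIsotropic {Ω : Type u} [MeasurableSpace Ω] (μ : Measure Ω) {N : ℕ}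
    (v : Ω → EuclideanSpace ℝ (Fin N)) : Prop :=
  ∀ p q : Fin N, ∫ ω, v ω p * v ω q ∂μ = if p = q then 1 else 0

/-- The `i`-th row of a matrix, as a vector of Euclidean space. -/
noncomputable def euclRow {m N : ℕ} (A : Matrix (Fin m) (Fin N) ℝ) (i : Fin m) :
    EuclideanSpace ℝ (Fin N) :=
  WithLp.toLp 2 (A i)

/-- A vector is `s`-sparse if it has at most `s` nonzero entries. -/
def IsSparse {N : ℕ} (s : ℕ) (v : EuclideanSpace ℝ (Fin N)) : Prop :=
  {i : Fin N | v i ≠ 0}.ncard ≤ s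

/-- `T` is a hard thresholding operator `T_s`: it keeps `s` entries of largest magnitude (all
entries, if `N ≤ s`) and sets the others to zero. Ties may be broken in any way. -/
def IsHardThresholding {N : ℕ} (s : ℕ)
    (T : EuclideanSpace ℝ (Fin N) → EuclideanSpace ℝ (Fin N)) : Prop :=
  ∀ v, ∃ S : Finset (Fin N), S.card = min s N ∧ (∀ i ∈ S, ∀ j ∉ S, |v j| ≤ |v i|) ∧
    ∀ i, T v i = if i ∈ S then v i else 0

/-- The orthogonal projection `P_S` of `ℝ^N` onto the span of the standard basis vectors with
index in `S`. -/
noncomputable def coordProj {N : ℕ} (S : Finset (Fin N)) (v : EuclideanSpace ℝ (Fin N)) :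
    EuclideanSpace ℝ (Fin N) :=
  WithLp.toLp 2 (fun i => if i ∈ S then v i else 0)

/-- One Kaczmarz step with step size `γ` along row `i` of the system `A x = b`. -/
noncomputable def kaczmarzStep {m N : ℕ} (A : Matrix (Fin m) (Fin N) ℝ) (b : Fin m → ℝ) (γ : ℝ)
    (i : Fin m) (z : EuclideanSpace ℝ (Fin N)) : EuclideanSpace ℝ (Fin N) :=
  z + (γ * ((b i - inner ℝ (euclRow A i) z) / ‖euclRow A i‖ ^ 2)) • euclRow A i

/-- The Kaczmarz loop started at `z`: the value after the first `j` steps, which use the rows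
`τ 0, …, τ (j - 1)` in this order (a sweep has `m` steps). -/
noncomputable def kaczmarzLoop {m N : ℕ} (A : Matrix (Fin m) (Fin N) ℝ) (b : Fin m → ℝ) (γ : ℝ)
    (τ : Equiv.Perm (Fin m)) (z : EuclideanSpace ℝ (Fin N)) : ℕ → EuclideanSpace ℝ (Fin N)
  | 0 => z
  | j + 1 =>
    if h : j < m then kaczmarzStep A b γ (τ ⟨j, h⟩) (kaczmarzLoop A b γ τ z j)
    else kaczmarzLoop A b γ τ z j

/-- The outer iterates of KZPT with period `m`, inner step size `γ`, gradient step size `lam`,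
thresholding operator `T` and row order `τ k` in epoch `k`. Counting starts at `0`: the value at
`k` is the iterate that is usually written `x^{k+1}_1`. -/
noncomputable def kzpt {m N : ℕ} (A : Matrix (Fin m) (Fin N) ℝ) (b : Fin m → ℝ) (γ lam : ℝ)
    (T : EuclideanSpace ℝ (Fin N) → EuclideanSpace ℝ (Fin N)) (τ : ℕ → Equiv.Perm (Fin m)) :
    ℕ → EuclideanSpace ℝ (Fin N)
  | 0 => 0
  | k + 1 =>
    T (kzpt A b γ lam T τ k +
      lam • (kaczmarzLoop A b γ (τ k) (kzpt A b γ lam T τ k) m - kzpt A b γ lam T τ k))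

/-! During a sweep with a tiny step size the iterate hardly moves, so each row meets nearly the
residual it would have met at the start. The rescaled displacement of the sweep is therefore the
gradient step (1/m) Aᵀ(b - A z) up to an error of second order, bounded uniformly in the row order
(`norm_smul_kaczmarzLoop_sub_le`), and an epoch is a perturbed step of iterative hard thresholding.

If A has restricted isometry constant δ at order 3s, then 1 - AᵀA/m, compressed to the relevant
supports, contracts by δ. The sweep error costs at most another δ, and thresholding doubles the sum:
this is the rate 4δ (`HasRIP.norm_epoch_sub_le`). This half is deterministic, so one good event for
A serves all x, e and permutations, even those depending on A.

The isometry property holds with high probability by Bernstein's inequality in each fixed direction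
and a union bound over a finite grid of sparse vectors (`exists_measurableSet_hasRIP`). The crude
grid count is affordable because the Bernstein exponent carries a factor s ln(N/s) ln²m, while the
logarithm of the count is of order s (ln m + ln(N/s)) (`grid_card_mul_exp_le`). For small ln m the
probability bound is trivial. -/

/-! ### Kaczmarz sweeps as perturbed gradient steps. -/

/-- Solving the triangular system of residuals of a sweep perturbs the weighted sum of the rows by a
term of second order. -/
theorem norm_sum_smul_sub_sum_smul_le {E : Type*} [NormedAddCommGroup E] [InnerProductSpace ℝ E]
    {m : ℕ} {v : Fin m → E} {r η : ℝ} {d g : Fin m → ℝ} (hη : 0 ≤ η)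
    (hv : ∀ i, ‖v i‖ ≤ r)
    (hd : ∀ j, d j = g j - η * ∑ i with i < j, d i * inner ℝ (v j) (v i))
    (hsmall : m * (η * r ^ 2) ≤ 1 / 2) :
    ‖∑ j, d j • v j - ∑ j, g j • v j‖ ≤ 2 * m * η * r ^ 3 * ∑ j, |g j| := by
  rcases Nat.eq_zero_or_pos m with rfl | hm
  · simp
  have hr : 0 ≤ r := (norm_nonneg _).trans (hv ⟨0, hm⟩)
  have hdiff : ∀ j, |d j - g j| ≤ η * r ^ 2 * ∑ i, |d i| := by
    intro j
    have h1 : d j - g j = -(η * ∑ i with i < j, d i * inner ℝ (v j) (v i)) := by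
      rw [hd j]; ring
    rw [h1, abs_neg, abs_mul, abs_of_nonneg hη, mul_assoc]
    gcongr
    calc |∑ i with i < j, d i * inner ℝ (v j) (v i)|
        ≤ ∑ i with i < j, |d i * inner ℝ (v j) (v i)| := Finset.abs_sum_le_sum_abs _ _
      _ ≤ ∑ i, |d i * inner ℝ (v j) (v i)| :=
          Finset.sum_le_sum_of_subset_of_nonneg (Finset.filter_subset _ _)
            fun _ _ _ => abs_nonneg _
      _ ≤ ∑ i, r ^ 2 * |d i| := by
          gcongr with i
          rw [abs_mul, mul_comm]
          gcongr
          calc |inner ℝ (v j) (v i)| ≤ ‖v j‖ * ‖v i‖ := abs_real_inner_le_norm _ _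
            _ ≤ r * r := by gcongr <;> exact hv _
            _ = r ^ 2 := by ring
      _ = r ^ 2 * ∑ i, |d i| := by rw [Finset.mul_sum]
  have hsum : ∑ j, |d j - g j| ≤ m * (η * r ^ 2) * ∑ i, |d i| := by
    calc ∑ j, |d j - g j| ≤ ∑ _j : Fin m, η * r ^ 2 * ∑ i, |d i| := by gcongr with j; exact hdiff j
      _ = _ := by simp [mul_assoc]
  have hD0 : 0 ≤ ∑ i, |d i| := Finset.sum_nonneg fun _ _ => abs_nonneg _
  -- Absorption: by `hsmall` at most half of the ℓ¹ norm of `d` comes from the feedback term.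
  have hD : ∑ i, |d i| ≤ 2 * ∑ i, |g i| := by
    have : ∑ i, |d i| ≤ ∑ i, |g i| + ∑ i, |d i - g i| := by
      rw [← Finset.sum_add_distrib]
      gcongr with i
      calc |d i| = |g i + (d i - g i)| := by ring_nf
        _ ≤ _ := abs_add_le _ _
    nlinarith
  rw [← Finset.sum_sub_distrib]
  simp_rw [← sub_smul]
  calc ‖∑ j, (d j - g j) • v j‖ ≤ ∑ j, ‖(d j - g j) • v j‖ := norm_sum_le _ _
    _ ≤ ∑ j, |d j - g j| * r := by
        gcongr with j
        rw [norm_smul, Real.norm_eq_abs]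
        gcongr
        exact hv j
    _ = (∑ j, |d j - g j|) * r := by rw [Finset.sum_mul]
    _ ≤ (m * (η * r ^ 2) * (2 * ∑ i, |g i|)) * r := by
        gcongr
        exact hsum.trans (by gcongr)
    _ = _ := by ring

/-- Inserting this formula into the residual of step j expresses it through the earlier residuals,
which is the triangular system solved above with `η = γ / R`. -/
theorem kaczmarzLoop_eq_add_sum {m N : ℕ} (A : Matrix (Fin m) (Fin N) ℝ) (b : Fin m → ℝ) {γ R : ℝ}
    (τ : Equiv.Perm (Fin m)) (z : EuclideanSpace ℝ (Fin N))
    (hrow : ∀ i, ‖euclRow A i‖ ^ 2 = R) {j : ℕ} (hj : j ≤ m) :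
    kaczmarzLoop A b γ τ z j = z + (γ / R) • ∑ i : Fin m with i.val < j,
      (b (τ i) - inner ℝ (euclRow A (τ i)) (kaczmarzLoop A b γ τ z i)) • euclRow A (τ i) := by
  induction j with
  | zero => simp [kaczmarzLoop]
  | succ j ih =>
    have hlt : j < m := hj
    have hfil : (Finset.univ.filter fun i : Fin m => i.val < j + 1) =
        insert ⟨j, hlt⟩ (Finset.univ.filter fun i : Fin m => i.val < j) := by
      ext i
      simp only [Finset.mem_filter, Finset.mem_univ, true_and, Finset.mem_insert, Fin.ext_iff]
      omega
    rw [hfil, Finset.sum_insert (by simp), smul_add]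
    have hunf : kaczmarzLoop A b γ τ z (j + 1) =
        kaczmarzStep A b γ (τ ⟨j, hlt⟩) (kaczmarzLoop A b γ τ z j) := by
      simp [kaczmarzLoop, hlt]
    rw [hunf, kaczmarzStep, hrow, smul_smul]
    have := ih hlt.le
    have hc : γ * ((b (τ ⟨j, hlt⟩) - inner ℝ (euclRow A (τ ⟨j, hlt⟩)) (kaczmarzLoop A b γ τ z j)) / R)
      = γ / R * (b (τ ⟨j, hlt⟩) - inner ℝ (euclRow A (τ ⟨j, hlt⟩)) (kaczmarzLoop A b γ τ z j)) := by
      ring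
    rw [hc]
    nth_rewrite 1 [this]
    abel

/-- A sweep of small step size is a gradient step up to an error of second order. -/
theorem norm_smul_kaczmarzLoop_sub_le {m N : ℕ} (A : Matrix (Fin m) (Fin N) ℝ) (b : Fin m → ℝ)
    {γ lam R : ℝ} (τ : Equiv.Perm (Fin m)) (z : EuclideanSpace ℝ (Fin N)) (hR : 0 ≤ R)
    (hγ : 0 ≤ γ) (hrow : ∀ i, ‖euclRow A i‖ = √R)
    (hlam : lam * (γ / R) = 1 / m) (hsmall : m * γ ≤ 1 / 2) :
    ‖lam • (kaczmarzLoop A b γ τ z m - z)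
        - (1 / m : ℝ) • ∑ i, (b i - inner ℝ (euclRow A i) z) • euclRow A i‖
      ≤ 2 * γ * √R * ∑ i, |b i - inner ℝ (euclRow A i) z| := by
  rcases Nat.eq_zero_or_pos m with rfl | hm
  · simp [kaczmarzLoop]
  have hm' : (0 : ℝ) < m := by exact_mod_cast hm
  -- With `R = 0`, division by zero would make the left side of `hlam` zero, but `1 / m` is not.
  have hR0 : R ≠ 0 := by
    rintro rfl
    rw [div_zero, mul_zero, eq_comm, one_div, inv_eq_zero] at hlam
    exact hm'.ne' hlam
  have hRp : 0 < R := lt_of_le_of_ne hR hR0.symm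
  have hsq : √R ^ 2 = R := Real.sq_sqrt hR
  have hrow2 : ∀ i, ‖euclRow A i‖ ^ 2 = R := fun i => by rw [hrow, hsq]
  set d : Fin m → ℝ := fun i =>
    b (τ i) - inner ℝ (euclRow A (τ i)) (kaczmarzLoop A b γ τ z i) with hd
  set g : Fin m → ℝ := fun i => b (τ i) - inner ℝ (euclRow A (τ i)) z with hg
  have key := norm_sum_smul_sub_sum_smul_le (v := fun i => euclRow A (τ i)) (r := √R) (η := γ / R)
    (d := d) (g := g) (by positivity) (fun i => (hrow _).le) (fun j => by
      simp only [hd, hg]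
      rw [kaczmarzLoop_eq_add_sum A b τ z hrow2 j.2.le, inner_add_right, inner_smul_right,
        inner_sum]
      simp_rw [inner_smul_right]
      simp only [Fin.lt_def]
      ring) (by rw [hsq]; field_simp; linarith)
  have hloop : lam • (kaczmarzLoop A b γ τ z m - z) = (1 / m : ℝ) • ∑ i, d i • euclRow A (τ i) := by
    rw [kaczmarzLoop_eq_add_sum A b τ z hrow2 le_rfl, add_sub_cancel_left, smul_smul, hlam]
    simp [hd]
  have hre : ∑ i, (b i - inner ℝ (euclRow A i) z) • euclRow A i = ∑ i, g i • euclRow A (τ i) :=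
    (Equiv.sum_comp τ fun i => (b i - inner ℝ (euclRow A i) z) • euclRow A i).symm
  have hre2 : ∑ i, |b i - inner ℝ (euclRow A i) z| = ∑ i, |g i| :=
    (Equiv.sum_comp τ fun i => |b i - inner ℝ (euclRow A i) z|).symm
  rw [hloop, hre, hre2, ← smul_sub, norm_smul, Real.norm_of_nonneg (by positivity)]
  calc 1 / (m : ℝ) * ‖∑ i, d i • euclRow A (τ i) - ∑ i, g i • euclRow A (τ i)‖
      ≤ 1 / (m : ℝ) * (2 * m * (γ / R) * √R ^ 3 * ∑ j, |g j|) := by gcongr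
    _ = 2 * γ * √R * ∑ i, |g i| := by
        have : √R ^ 3 = R * √R := by rw [pow_succ, hsq]
        rw [this]; field_simp

/-! ### Coordinate projections and hard thresholding. -/

theorem norm_coordProj_le {N : ℕ} (S : Finset (Fin N)) (v : EuclideanSpace ℝ (Fin N)) :
    ‖coordProj S v‖ ≤ ‖v‖ := by
  rw [EuclideanSpace.norm_eq, EuclideanSpace.norm_eq]
  gcongr with i
  simp only [coordProj]
  split_ifs <;> simp

theorem coordProj_add {N : ℕ} (S : Finset (Fin N)) (v w : EuclideanSpace ℝ (Fin N)) :
    coordProj S (v + w) = coordProj S v + coordProj S w := by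
  ext i
  simp only [coordProj, PiLp.add_apply]
  split_ifs <;> simp

theorem norm_coordProj_sq {N : ℕ} (S : Finset (Fin N)) (v : EuclideanSpace ℝ (Fin N)) :
    ‖coordProj S v‖ ^ 2 = inner ℝ v (coordProj S v) := by
  rw [EuclideanSpace.norm_sq_eq, PiLp.inner_apply]
  refine Finset.sum_congr rfl fun i _ => ?_
  simp only [coordProj]
  split_ifs <;> simp [sq]

theorem IsHardThresholding.isSparse {N s : ℕ}
    {T : EuclideanSpace ℝ (Fin N) → EuclideanSpace ℝ (Fin N)} (hT : IsHardThresholding s T)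
    (v : EuclideanSpace ℝ (Fin N)) : IsSparse s (T v) := by
  obtain ⟨S, hS, -, h⟩ := hT v
  unfold IsSparse
  calc {i : Fin N | T v i ≠ 0}.ncard ≤ (S : Set (Fin N)).ncard := by
        apply Set.ncard_le_ncard _ S.finite_toSet
        intro i hi
        by_contra hc
        exact hi (by rw [h, if_neg (by simpa using hc)])
    _ ≤ s := by rw [Set.ncard_coe_finset]; omega

/-- If every entry of `u` with index in `S` dominates every other entry, then the entries indexed by
`S` carry at least as much energy as any set of the same cardinality. -/
theorem sum_sq_sdiff_le_of_dominates {N : ℕ} {S X : Finset (Fin N)} {u : Fin N → ℝ}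
    (hcard : X.card ≤ S.card) (hS : ∀ i ∈ S, ∀ j ∉ S, |u j| ≤ |u i|) :
    ∑ i ∈ X \ S, u i ^ 2 ≤ ∑ i ∈ S \ X, u i ^ 2 := by
  have hc : (X \ S).card ≤ (S \ X).card := by
    have := Finset.card_sdiff_add_card_inter X S
    have := Finset.card_sdiff_add_card_inter S X
    rw [Finset.inter_comm] at this
    omega
  -- Each entry in `X \ S` is paired with its own dominating entry in `S \ X`.
  obtain ⟨f⟩ : Nonempty ((X \ S : Finset (Fin N)) ↪ (S \ X : Finset (Fin N))) := by
    apply Function.Embedding.nonempty_of_card_le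
    rwa [Fintype.card_coe, Fintype.card_coe]
  rw [← Finset.sum_coe_sort (X \ S), ← Finset.sum_coe_sort (S \ X)]
  calc ∑ i : (X \ S : Finset (Fin N)), u i ^ 2 ≤ ∑ i : (X \ S : Finset (Fin N)), u (f i) ^ 2 := by
        refine Finset.sum_le_sum fun i _ => sq_le_sq.mpr ?_
        exact hS _ (Finset.mem_sdiff.mp (f i).2).1 _ (Finset.mem_sdiff.mp i.2).2
    _ = ∑ j ∈ Finset.univ.map f, u j ^ 2 := by rw [Finset.sum_map]
    _ ≤ ∑ j : (S \ X : Finset (Fin N)), u j ^ 2 := Finset.sum_le_sum_of_subset_of_nonneg (Finset.subset_univ _)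
          fun _ _ _ => sq_nonneg _

/-- Hard thresholding is at most twice as far from a sparse vector as the thresholded vector,
measured on the joint support. -/
theorem IsHardThresholding.exists_norm_sub_le {N s : ℕ}
    {T : EuclideanSpace ℝ (Fin N) → EuclideanSpace ℝ (Fin N)} (hT : IsHardThresholding s T)
    (hsN : s ≤ N) {X : Finset (Fin N)} (hX : X.card ≤ s) {x : EuclideanSpace ℝ (Fin N)}
    (hx : ∀ i ∉ X, x i = 0) (u : EuclideanSpace ℝ (Fin N)) :
    ∃ S : Finset (Fin N), S.card ≤ s ∧ ‖T u - x‖ ≤ 2 * ‖coordProj (S ∪ X) (u - x)‖ := by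
  obtain ⟨S, hS, hdom, h⟩ := hT u
  have hSs : S.card = s := by omega
  refine ⟨S, hSs.le, ?_⟩
  -- The two vectors differ only on `X \ S`. The energy of `u` there is at most that on `S \ X`,
  -- where `x` vanishes and `u` equals `u - x`.
  have h1 : ‖T u - coordProj (S ∪ X) u‖ ≤ ‖coordProj (S ∪ X) (u - x)‖ := by
    apply le_of_sq_le_sq _ (norm_nonneg _)
    have hle := sum_sq_sdiff_le_of_dominates (u := u) (hX.trans hSs.ge) hdom
    have e1 : ‖T u - coordProj (S ∪ X) u‖ ^ 2 = ∑ i ∈ X \ S, u i ^ 2 := by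
      rw [EuclideanSpace.norm_sq_eq, ← Finset.sum_filter_add_sum_filter_not _ (fun i => i ∈ X \ S)]
      rw [Finset.sum_eq_zero (s := Finset.univ.filter fun i => ¬ i ∈ X \ S), add_zero]
      · refine Finset.sum_congr (by ext; simp) fun i hi => ?_
        obtain ⟨hi1, hi2⟩ := Finset.mem_sdiff.mp hi
        simp [coordProj, h, hi1, hi2]
      · intro i hi
        simp only [Finset.mem_filter, Finset.mem_sdiff, not_and, not_not, Finset.mem_univ,
          true_and] at hi
        by_cases hiS : i ∈ S
        · simp [coordProj, h, hiS]
        · have : i ∉ X := fun hc => hiS (hi hc)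
          simp [coordProj, h, hiS, this]
    have e2 : ∑ i ∈ S \ X, u i ^ 2 ≤ ‖coordProj (S ∪ X) (u - x)‖ ^ 2 := by
      rw [EuclideanSpace.norm_sq_eq]
      calc ∑ i ∈ S \ X, u i ^ 2 = ∑ i ∈ S \ X, ‖coordProj (S ∪ X) (u - x) i‖ ^ 2 := by
            refine Finset.sum_congr rfl fun i hi => ?_
            obtain ⟨hi1, hi2⟩ := Finset.mem_sdiff.mp hi
            simp [coordProj, hi1, hx i hi2]
        _ ≤ _ := Finset.sum_le_sum_of_subset_of_nonneg (Finset.subset_univ _)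
            fun _ _ _ => sq_nonneg _
    linarith
  have h2 : T u - x = (T u - coordProj (S ∪ X) u) + coordProj (S ∪ X) (u - x) := by
    have : coordProj (S ∪ X) (u - x) = coordProj (S ∪ X) u - x := by
      ext i
      simp only [coordProj, PiLp.sub_apply]
      split_ifs with hi
      · rfl
      · simp [hx i fun hc => hi (Finset.mem_union_right _ hc)]
    rw [this]; abel
  rw [h2]
  calc _ ≤ ‖T u - coordProj (S ∪ X) u‖ + ‖coordProj (S ∪ X) (u - x)‖ := norm_add_le _ _
    _ ≤ _ := by linarith

/-! ### Restricted isometry and convergence of the outer iteration. -/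

/-- The restricted isometry property of order `d` with constant `δ`, as a bound of the bilinear form
of `Aᵀ A / m - 1` on vectors with common support. -/
def HasRIP {m N : ℕ} (A : Matrix (Fin m) (Fin N) ℝ) (d : ℕ) (δ : ℝ) : Prop :=
  ∀ S : Finset (Fin N), S.card ≤ d → ∀ u v : EuclideanSpace ℝ (Fin N),
    (∀ i ∉ S, u i = 0) → (∀ i ∉ S, v i = 0) →
    |1 / m * ∑ i, inner ℝ (euclRow A i) u * inner ℝ (euclRow A i) v - inner ℝ u v|
      ≤ δ * (‖u‖ * ‖v‖)

/-- Duality: the squared norm of the projection is the inner product of `y` with its own projection,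
that is, minus the bilinear form tested on `h` and that projection. -/
theorem HasRIP.norm_coordProj_sub_le {m N d : ℕ} {A : Matrix (Fin m) (Fin N) ℝ} {δ : ℝ}
    (hA : HasRIP A d δ) {S W : Finset (Fin N)} (hSW : (W ∪ S).card ≤ d)
    {h : EuclideanSpace ℝ (Fin N)} (hh : ∀ i ∉ S, h i = 0) :
    ‖coordProj W (h - (1 / m : ℝ) • ∑ i, inner ℝ (euclRow A i) h • euclRow A i)‖ ≤ δ * ‖h‖ := by
  set y := h - (1 / m : ℝ) • ∑ i, inner ℝ (euclRow A i) h • euclRow A i with hy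
  rcases (norm_nonneg (coordProj W y)).eq_or_lt with h0 | hpos
  -- No sign of `δ` is assumed; it is read off from the isometry bound at `h` itself.
  · rw [← h0]
    by_cases hz : h = 0
    · simp [hz]
    · have := hA (W ∪ S) hSW h h (fun i hi => hh i fun hc => hi (Finset.mem_union_right _ hc))
        (fun i hi => hh i fun hc => hi (Finset.mem_union_right _ hc))
      have h1 := (abs_nonneg _).trans this
      have : 0 < ‖h‖ := norm_pos_iff.mpr hz
      by_contra! hneg
      nlinarith
  · have key := hA (W ∪ S) hSW h (coordProj W y)
      (fun i hi => hh i fun hc => hi (Finset.mem_union_right _ hc))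
      (fun i hi => by simp [coordProj, show i ∉ W from fun hc => hi (Finset.mem_union_left _ hc)])
    have e : ‖coordProj W y‖ ^ 2 = -(1 / m * ∑ i, inner ℝ (euclRow A i) h *
        inner ℝ (euclRow A i) (coordProj W y) - inner ℝ h (coordProj W y)) := by
      rw [norm_coordProj_sq]
      nth_rewrite 1 [hy]
      rw [inner_sub_left, real_inner_smul_left, sum_inner]
      simp_rw [real_inner_smul_left]
      ring
    have : ‖coordProj W y‖ ^ 2 ≤ δ * ‖h‖ * ‖coordProj W y‖ := by
      rw [e, mul_assoc]
      exact (neg_le_abs _).trans key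
    rw [sq] at this
    exact le_of_mul_le_mul_right this hpos

/-- Cauchy–Schwarz passes from ℓ¹ to ℓ², and `1 + δ ≤ 4 = 2²` gives the factor 2. -/
theorem HasRIP.sum_abs_inner_le {m N d : ℕ} {A : Matrix (Fin m) (Fin N) ℝ} {δ : ℝ} (hm : 0 < m)
    (hA : HasRIP A d δ) (hδ : δ ≤ 3) {S : Finset (Fin N)} (hS : S.card ≤ d)
    {h : EuclideanSpace ℝ (Fin N)} (hh : ∀ i ∉ S, h i = 0) :
    ∑ i, |inner ℝ (euclRow A i) h| ≤ m * (2 * ‖h‖) := by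
  have hm' : (0 : ℝ) < m := by exact_mod_cast hm
  have key := (abs_le.mp (hA S hS h h hh hh)).2
  rw [real_inner_self_eq_norm_sq] at key
  have h1 : ∑ i, inner ℝ (euclRow A i) h * inner ℝ (euclRow A i) h ≤ m * (2 * ‖h‖) ^ 2 := by
    have : 1 / (m : ℝ) * ∑ i, inner ℝ (euclRow A i) h * inner ℝ (euclRow A i) h
        ≤ (2 * ‖h‖) ^ 2 := by nlinarith [sq_nonneg ‖h‖]
    rwa [one_div, inv_mul_le_iff₀ hm'] at this
  apply le_of_sq_le_sq _ (by positivity)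
  calc (∑ i, |inner ℝ (euclRow A i) h|) ^ 2
      ≤ m * ∑ i, |inner ℝ (euclRow A i) h| ^ 2 := by
        simpa using sq_sum_le_card_mul_sum_sq (s := Finset.univ)
          (f := fun i => |inner ℝ (euclRow A i) h|)
    _ ≤ m * (m * (2 * ‖h‖) ^ 2) := by
        gcongr
        simpa [sq_abs, sq] using h1
    _ = _ := by ring

theorem IsSparse.exists_finset {N s : ℕ} {v : EuclideanSpace ℝ (Fin N)} (hv : IsSparse s v) :
    ∃ X : Finset (Fin N), X.card ≤ s ∧ ∀ i ∉ X, v i = 0 := by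
  classical
  refine ⟨Finset.univ.filter fun i => v i ≠ 0, ?_, fun i hi => by simpa using hi⟩
  have : {i : Fin N | v i ≠ 0} = (Finset.univ.filter fun i => v i ≠ 0 : Finset (Fin N)) := by
    ext; simp
  unfold IsSparse at hv
  rwa [this, Set.ncard_coe_finset] at hv

theorem toLp_transpose_mulVec {m N : ℕ} (A : Matrix (Fin m) (Fin N) ℝ) (e : Fin m → ℝ) (c : ℝ) :
    WithLp.toLp 2 (c • (Aᵀ *ᵥ e)) = c • ∑ i, e i • euclRow A i := by
  ext p
  simp [Matrix.mulVec, dotProduct, euclRow, WithLp.ofLp_sum, mul_comm]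

theorem mulVec_eq_inner_euclRow {m N : ℕ} (A : Matrix (Fin m) (Fin N) ℝ)
    (x : EuclideanSpace ℝ (Fin N)) (i : Fin m) :
    (A *ᵥ x.ofLp) i = inner ℝ (euclRow A i) x := by
  simp [Matrix.mulVec, dotProduct, euclRow, PiLp.inner_apply, mul_comm]

/-- With `h = z - x`, the error before thresholding is (1 - AᵀA/m) h + Aᵀe/m plus the sweep error.
Order 3s suffices because the supports of `x`, `z` and the thresholded vector are the only ones
involved. -/
theorem HasRIP.norm_epoch_sub_le {m N s : ℕ} {A : Matrix (Fin m) (Fin N) ℝ} {δ γ lam c : ℝ}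
    (hm : 0 < m) (hsN : s ≤ N) (hA : HasRIP A (3 * s) δ) (hδ : δ ≤ 1 / 4)
    (hγ : 0 ≤ γ) (hrow : ∀ i, ‖euclRow A i‖ = √(N : ℝ))
    (hlam : lam * (γ / N) = 1 / m) (hsmall : m * γ ≤ 1 / 2)
    (hc : 2 * γ * √(N : ℝ) ≤ c / m) (hcδ : c ≤ δ / 2)
    {T : EuclideanSpace ℝ (Fin N) → EuclideanSpace ℝ (Fin N)} (hT : IsHardThresholding s T)
    {x z : EuclideanSpace ℝ (Fin N)} (hx : IsSparse s x) (hz : IsSparse s z) (e : Fin m → ℝ)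
    (τ : Equiv.Perm (Fin m)) :
    ‖T (z + lam • (kaczmarzLoop A (A *ᵥ x.ofLp + e) γ τ z m - z)) - x‖ ≤
      4 * δ * ‖z - x‖
      + (2 * (⨆ S : {S : Finset (Fin N) // S.card ≤ 2 * s},
          ‖coordProj S.1 (WithLp.toLp 2 ((1 / (m : ℝ)) • (Aᵀ *ᵥ e)))‖)
        + 2 * c * ((∑ i, |e i|) / m)) := by
  have hm' : (0 : ℝ) < m := by exact_mod_cast hm
  obtain ⟨X, hXs, hX⟩ := hx.exists_finset
  obtain ⟨Z, hZs, hZ⟩ := hz.exists_finset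
  set u := z + lam • (kaczmarzLoop A (A *ᵥ x.ofLp + e) γ τ z m - z) with hu
  obtain ⟨S, hSs, hS⟩ := hT.exists_norm_sub_le hsN hXs hX u
  set h := z - x with hh
  have hsupp : ∀ i ∉ X ∪ Z, h i = 0 := by
    intro i hi
    simp only [Finset.mem_union, not_or] at hi
    simp [hh, hX i hi.1, hZ i hi.2]
  have hW : (S ∪ X).card ≤ 2 * s := (Finset.card_union_le _ _).trans (by omega)
  have hWX : ((S ∪ X) ∪ (X ∪ Z)).card ≤ 3 * s := by
    have : (S ∪ X) ∪ (X ∪ Z) = (S ∪ X) ∪ Z := by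
      ext; simp only [Finset.mem_union]; tauto
    rw [this]
    exact (Finset.card_union_le _ _).trans (by omega)
  have hXZ : (X ∪ Z).card ≤ 3 * s := (Finset.card_union_le _ _).trans (by omega)
  have hres : ∀ i, (A *ᵥ x.ofLp + e) i - inner ℝ (euclRow A i) z
      = e i - inner ℝ (euclRow A i) h := by
    intro i
    rw [Pi.add_apply, mulVec_eq_inner_euclRow, hh, inner_sub_right]
    ring
  have herr := norm_smul_kaczmarzLoop_sub_le A (A *ᵥ x.ofLp + e) τ z (Nat.cast_nonneg N) hγ hrow
    hlam hsmall
  simp_rw [hres] at herr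
  set err := lam • (kaczmarzLoop A (A *ᵥ x.ofLp + e) γ τ z m - z)
    - (1 / m : ℝ) • ∑ i, (e i - inner ℝ (euclRow A i) h) • euclRow A i with herrdef
  -- The sweep error is controlled by the residuals at the start of the epoch: the noise enters
  -- through its ℓ¹ norm, the signal part through `‖h‖`.
  have hG : ∑ i, |e i - inner ℝ (euclRow A i) h| ≤ ∑ i, |e i| + m * (2 * ‖h‖) := by
    refine le_trans ?_ (add_le_add le_rfl (hA.sum_abs_inner_le hm (by linarith) hXZ hsupp))
    rw [← Finset.sum_add_distrib]
    gcongr with i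
    exact abs_sub _ _
  have herr' : ‖err‖ ≤ δ * ‖h‖ + c * ((∑ i, |e i|) / m) := by
    have h0 : 0 ≤ c / m := le_trans (by positivity) hc
    calc ‖err‖ ≤ c / m * (∑ i, |e i| + m * (2 * ‖h‖)) := by
          refine herr.trans (mul_le_mul hc hG ?_ h0)
          exact Finset.sum_nonneg fun _ _ => abs_nonneg _
      _ = 2 * c * ‖h‖ + c * ((∑ i, |e i|) / m) := by field_simp; ring
      _ ≤ _ := by
          gcongr
          linarith
  have hdecomp : u - x = (h - (1 / m : ℝ) • ∑ i, inner ℝ (euclRow A i) h • euclRow A i)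
      + (1 / m : ℝ) • ∑ i, e i • euclRow A i + err := by
    have hsplit : (1 / m : ℝ) • ∑ i, (e i - inner ℝ (euclRow A i) h) • euclRow A i =
        (1 / m : ℝ) • ∑ i, e i • euclRow A i
          - (1 / m : ℝ) • ∑ i, inner ℝ (euclRow A i) h • euclRow A i := by
      rw [← smul_sub, ← Finset.sum_sub_distrib]
      simp_rw [sub_smul]
    rw [herrdef, hsplit, hu]
    nth_rewrite 1 [hh]
    abel
  have hP : ‖coordProj (S ∪ X) (u - x)‖ ≤ δ * ‖h‖
      + (⨆ S : {S : Finset (Fin N) // S.card ≤ 2 * s},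
          ‖coordProj S.1 (WithLp.toLp 2 ((1 / (m : ℝ)) • (Aᵀ *ᵥ e)))‖) + ‖err‖ := by
    rw [hdecomp, coordProj_add, coordProj_add]
    refine (norm_add₃_le).trans ?_
    gcongr
    · exact hA.norm_coordProj_sub_le hWX hsupp
    · rw [← toLp_transpose_mulVec]
      exact le_ciSup (f := fun S : {S : Finset (Fin N) // S.card ≤ 2 * s} =>
        ‖coordProj S.1 (WithLp.toLp 2 ((1 / (m : ℝ)) • (Aᵀ *ᵥ e)))‖)
        (Set.finite_range _).bddAbove ⟨S ∪ X, hW⟩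
    · exact norm_coordProj_le _ _
  linarith

theorem le_pow_mul_add_div_of_le_mul_add {a : ℕ → ℝ} {q B : ℝ} (hq : 0 ≤ q) (hq1 : q < 1)
    (hB : 0 ≤ B) (h : ∀ k, a (k + 1) ≤ q * a k + B) (k : ℕ) :
    a k ≤ q ^ k * a 0 + B / (1 - q) := by
  have h1 : 0 < 1 - q := by linarith
  induction k with
  | zero => simpa using div_nonneg hB h1.le
  | succ k ih =>
    calc a (k + 1) ≤ q * (q ^ k * a 0 + B / (1 - q)) + B := (h k).trans (by gcongr)
      _ = _ := by field_simp; ring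

theorem HasRIP.norm_kzpt_sub_le {m N s : ℕ} {A : Matrix (Fin m) (Fin N) ℝ} {δ γ lam c : ℝ}
    (hm : 0 < m) (hsN : s ≤ N) (hA : HasRIP A (3 * s) δ) (hδ0 : 0 ≤ δ) (hδ : δ < 1 / 4)
    (hγ : 0 ≤ γ) (hrow : ∀ i, ‖euclRow A i‖ = √(N : ℝ))
    (hlam : lam * (γ / N) = 1 / m) (hsmall : m * γ ≤ 1 / 2) (hc0 : 0 ≤ c)
    (hc : 2 * γ * √(N : ℝ) ≤ c / m) (hcδ : c ≤ δ / 2)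
    {T : EuclideanSpace ℝ (Fin N) → EuclideanSpace ℝ (Fin N)} (hT : IsHardThresholding s T)
    {x : EuclideanSpace ℝ (Fin N)} (hx : IsSparse s x) (e : Fin m → ℝ)
    (τ : ℕ → Equiv.Perm (Fin m)) (k : ℕ) :
    ‖kzpt A (A *ᵥ x.ofLp + e) γ lam T τ k - x‖ ≤
      (4 * δ) ^ k * ‖kzpt A (A *ᵥ x.ofLp + e) γ lam T τ 0 - x‖
      + 2 / (1 - 4 * δ) * (⨆ S : {S : Finset (Fin N) // S.card ≤ 2 * s},
          ‖coordProj S.1 (WithLp.toLp 2 ((1 / (m : ℝ)) • (Aᵀ *ᵥ e)))‖)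
      + 2 * c * ((∑ i, |e i|) / ((1 - 4 * δ) * m)) := by
  have hsparse : ∀ k, IsSparse s (kzpt A (A *ᵥ x.ofLp + e) γ lam T τ k) := by
    intro k
    cases k with
    | zero => simp [kzpt, IsSparse]
    | succ k => exact hT.isSparse _
  have := le_pow_mul_add_div_of_le_mul_add
    (a := fun k => ‖kzpt A (A *ᵥ x.ofLp + e) γ lam T τ k - x‖) (q := 4 * δ)
    (by linarith) (by linarith)
    (add_nonneg (mul_nonneg zero_le_two (Real.iSup_nonneg fun _ => norm_nonneg _))
      (mul_nonneg (by linarith) (div_nonneg (Finset.sum_nonneg fun _ _ => abs_nonneg _)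
        (Nat.cast_nonneg m))))
    (fun k => hA.norm_epoch_sub_le hm hsN hδ.le hγ hrow hlam hsmall hc hcδ hT hx (hsparse k) e (τ k))
    k
  refine this.trans (le_of_eq ?_)
  have : 1 - 4 * δ ≠ 0 := by linarith
  have : (m : ℝ) ≠ 0 := by positivity
  field_simp
  ring

/-! ### Sub-Gaussian marginals and Bernstein's inequality. -/

theorem Real.exp_le_one_add_add_sq_mul_exp_abs (u : ℝ) :
    Real.exp u ≤ 1 + u + u ^ 2 * Real.exp |u| := by
  have h := Complex.norm_exp_sub_sum_le_norm_mul_exp (u : ℂ) 2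
  have e : Complex.exp u - ∑ k ∈ Finset.range 2, (u : ℂ) ^ k / k.factorial
      = ((Real.exp u - (1 + u) : ℝ) : ℂ) := by
    simp [Finset.sum_range_succ]
  rw [e, Complex.norm_real, Complex.norm_real, Real.norm_eq_abs, Real.norm_eq_abs, sq_abs] at h
  linarith [le_abs_self (Real.exp u - (1 + u))]

/-- The strict inequality `K < κ` yields an admissible `t < κ`, so attainment of the infimum need
not be discussed. -/
theorem lintegral_exp_sq_div_le_of_psiTwoNorm_le {Ω : Type u} [MeasurableSpace Ω] {μ : Measure Ω}
    {X : Ω → ℝ} {K κ : ℝ} (hK : psiTwoNorm μ X ≤ ENNReal.ofReal K) (hκ : 0 < κ) (hlt : K < κ) :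
    ∫⁻ ω, ENNReal.ofReal (Real.exp (X ω ^ 2 / κ ^ 2)) ∂μ ≤ 2 := by
  have h : psiTwoNorm μ X < ENNReal.ofReal κ :=
    hK.trans_lt ((ENNReal.ofReal_lt_ofReal_iff hκ).mpr hlt)
  simp only [psiTwoNorm, iInf_lt_iff] at h
  obtain ⟨t, ht, hint, htκ⟩ := h
  have htκ' : t < κ := (ENNReal.ofReal_lt_ofReal_iff hκ).mp htκ
  refine (lintegral_mono fun ω => ?_).trans hint
  gcongr

theorem lintegral_exp_inner_sq_div_le {Ω : Type u} [MeasurableSpace Ω] {μ : Measure Ω} {N : ℕ}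
    {v : Ω → EuclideanSpace ℝ (Fin N)} {K κ : ℝ} (hK : vecPsiTwoNorm μ v ≤ ENNReal.ofReal K)
    (hκ : 0 < κ) (hlt : K < κ) {w : EuclideanSpace ℝ (Fin N)} (hw : ‖w‖ = 1) :
    ∫⁻ ω, ENNReal.ofReal (Real.exp (inner ℝ w (v ω) ^ 2 / κ ^ 2)) ∂μ ≤ 2 := by
  refine lintegral_exp_sq_div_le_of_psiTwoNorm_le (le_trans ?_ hK) hκ hlt
  exact le_iSup₂ (f := fun w (_ : w ∈ Metric.sphere (0 : EuclideanSpace ℝ (Fin N)) 1) =>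
    psiTwoNorm μ fun ω => inner ℝ w (v ω)) w (by simpa using hw)

section Bernstein

variable {Ω : Type u} [MeasurableSpace Ω] {μ : Measure Ω} [IsProbabilityMeasure μ]

theorem integrable_exp_mul_sq_of_bounded {X : Ω → ℝ} {B : ℝ} (hX : Measurable X)
    (hB : ∀ᵐ ω ∂μ, |X ω| ≤ B) (a b : ℝ) :
    Integrable (fun ω => Real.exp (a * (X ω ^ 2 - b))) μ := by
  refine Integrable.of_bound (by fun_prop) (Real.exp (|a| * (B ^ 2 + |b|))) ?_
  filter_upwards [hB] with ω hω
  rw [Real.norm_of_nonneg (Real.exp_pos _).le]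
  refine Real.exp_le_exp.mpr ((le_abs_self _).trans ?_)
  rw [abs_mul]
  gcongr
  refine (abs_sub _ _).trans ?_
  gcongr
  rw [abs_pow]
  gcongr

/-- A normalised squared sub-Gaussian variable is sub-exponential. -/
theorem mgf_sq_sub_one_le {X : Ω → ℝ} {B κ θ : ℝ} (hX : Measurable X) (hB : ∀ᵐ ω ∂μ, |X ω| ≤ B)
    (hκ : 1 ≤ κ) (hvar : ∫ ω, X ω ^ 2 ∂μ = 1)
    (hexp : ∫⁻ ω, ENNReal.ofReal (Real.exp (X ω ^ 2 / κ ^ 2)) ∂μ ≤ 2)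
    (hθ : |θ| ≤ 1 / (2 * κ ^ 2)) :
    mgf (fun ω => X ω ^ 2 - 1) μ θ ≤ Real.exp (48 * κ ^ 4 * θ ^ 2) := by
  have hκ0 : 0 < κ := by linarith
  have hint : Integrable (fun ω => Real.exp (X ω ^ 2 / κ ^ 2)) μ := by
    have := integrable_exp_mul_sq_of_bounded hX hB (1 / κ ^ 2) 0
    refine this.congr (ae_of_all _ fun ω => ?_)
    dsimp only
    congr 1
    ring
  have hsq : Integrable (fun ω => X ω ^ 2) μ := by
    refine Integrable.of_bound (by fun_prop) (B ^ 2) ?_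
    filter_upwards [hB] with ω hω
    rw [norm_pow, Real.norm_eq_abs]
    gcongr
  have hexp' : ∫ ω, Real.exp (X ω ^ 2 / κ ^ 2) ∂μ ≤ 2 := by
    rw [← ofReal_integral_eq_lintegral_ofReal hint (ae_of_all _ fun _ => (Real.exp_pos _).le)] at hexp
    exact (ENNReal.ofReal_le_ofReal_iff zero_le_two).mp (by simpa using hexp)
  -- Second-order Taylor bound whose linear term integrates to zero. The factor 24 is 8 (from `y² ≤
  -- 8 exp (y/2)`) times 3 (a bound for e).
  have hpt : ∀ x : ℝ, Real.exp (θ * (x ^ 2 - 1)) ≤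
      1 + θ * (x ^ 2 - 1) + 24 * κ ^ 4 * θ ^ 2 * Real.exp (x ^ 2 / κ ^ 2) := by
    intro x
    refine (Real.exp_le_one_add_add_sq_mul_exp_abs _).trans (add_le_add le_rfl ?_)
    set y := |x ^ 2 - 1| / κ ^ 2 with hy
    have hy0 : 0 ≤ y := by positivity
    have h1 : |θ * (x ^ 2 - 1)| ≤ y / 2 := by
      rw [abs_mul, hy]
      calc |θ| * |x ^ 2 - 1| ≤ 1 / (2 * κ ^ 2) * |x ^ 2 - 1| := by gcongr
        _ = _ := by field_simp
    have h2 : (x ^ 2 - 1) ^ 2 = κ ^ 4 * y ^ 2 := by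
      rw [hy, div_pow, sq_abs]; field_simp
    have h3 : y ^ 2 ≤ 8 * Real.exp (y / 2) := by
      have := Real.quadratic_le_exp_of_nonneg (x := y / 2) (by positivity)
      nlinarith
    have h4 : y ≤ x ^ 2 / κ ^ 2 + 1 := by
      rw [hy, div_add_one (by positivity)]
      gcongr
      refine (abs_sub _ _).trans ?_
      rw [abs_of_nonneg (sq_nonneg x), abs_one]
      nlinarith
    have h5 : Real.exp y ≤ 3 * Real.exp (x ^ 2 / κ ^ 2) := by
      calc Real.exp y ≤ Real.exp (x ^ 2 / κ ^ 2 + 1) := by gcongr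
        _ = Real.exp 1 * Real.exp (x ^ 2 / κ ^ 2) := by rw [Real.exp_add]; ring
        _ ≤ _ := by
          gcongr
          exact Real.exp_one_lt_three.le
    calc (θ * (x ^ 2 - 1)) ^ 2 * Real.exp |θ * (x ^ 2 - 1)|
        ≤ (θ * (x ^ 2 - 1)) ^ 2 * Real.exp (y / 2) := by gcongr
      _ = κ ^ 4 * θ ^ 2 * (y ^ 2 * Real.exp (y / 2)) := by rw [mul_pow, h2]; ring
      _ ≤ κ ^ 4 * θ ^ 2 * (8 * Real.exp (y / 2) * Real.exp (y / 2)) := by gcongr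
      _ = κ ^ 4 * θ ^ 2 * (8 * Real.exp y) := by
          rw [mul_assoc 8, ← Real.exp_add, add_halves]
      _ ≤ κ ^ 4 * θ ^ 2 * (8 * (3 * Real.exp (x ^ 2 / κ ^ 2))) := by gcongr
      _ = _ := by ring
  have hlin : Integrable (fun ω => 1 + θ * (X ω ^ 2 - 1)) μ :=
    (integrable_const _).add ((hsq.sub (integrable_const _)).const_mul _)
  calc mgf (fun ω => X ω ^ 2 - 1) μ θ
      ≤ ∫ ω, (1 + θ * (X ω ^ 2 - 1)) + 24 * κ ^ 4 * θ ^ 2 * Real.exp (X ω ^ 2 / κ ^ 2) ∂μ :=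
        integral_mono (integrable_exp_mul_sq_of_bounded hX hB θ 1) (hlin.add (hint.const_mul _))
          fun ω => hpt _
    _ = 1 + 24 * κ ^ 4 * θ ^ 2 * ∫ ω, Real.exp (X ω ^ 2 / κ ^ 2) ∂μ := by
        have hzero : ∫ ω, (1 + θ * (X ω ^ 2 - 1)) ∂μ = 1 := by
          have hsub : ∫ ω, (X ω ^ 2 - 1) ∂μ = 0 := by
            rw [integral_sub hsq (integrable_const _), hvar]
            simp
          have hmul : Integrable (fun ω => θ * (X ω ^ 2 - 1)) μ :=
            (hsq.sub (integrable_const _)).const_mul _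
          rw [integral_add (integrable_const _) hmul, integral_const_mul, hsub]
          simp
        rw [integral_add hlin (hint.const_mul _), integral_const_mul, hzero]
    _ ≤ 48 * κ ^ 4 * θ ^ 2 + 1 := by
        have : 0 ≤ 24 * κ ^ 4 * θ ^ 2 := by positivity
        nlinarith
    _ ≤ _ := Real.add_one_le_exp _

/-- Bernstein's inequality for the empirical second moment of independent sub-Gaussian variables. -/
theorem measure_abs_mean_sq_sub_one_gt_le {m : ℕ} (hm : 0 < m) {X : Fin m → Ω → ℝ} {B κ ε : ℝ}
    (hX : ∀ i, Measurable (X i)) (hB : ∀ i, ∀ᵐ ω ∂μ, |X i ω| ≤ B) (hind : iIndepFun X μ)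
    (hκ : 1 ≤ κ) (hvar : ∀ i, ∫ ω, X i ω ^ 2 ∂μ = 1)
    (hexp : ∀ i, ∫⁻ ω, ENNReal.ofReal (Real.exp (X i ω ^ 2 / κ ^ 2)) ∂μ ≤ 2)
    (hε : 0 ≤ ε) (hε1 : ε ≤ 1) :
    μ.real {ω | ε < |1 / (m : ℝ) * ∑ i, X i ω ^ 2 - 1|} ≤
      2 * Real.exp (-(m * ε ^ 2 / (192 * κ ^ 4))) := by
  have hm' : (0 : ℝ) < m := by exact_mod_cast hm
  have hκ0 : 0 < κ := by linarith
  set Y : Fin m → Ω → ℝ := fun i ω => X i ω ^ 2 - 1 with hY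
  have hYm : ∀ i, Measurable (Y i) := fun i => by simp only [hY]; fun_prop
  have hYind : iIndepFun Y μ := hind.comp (fun _ x => x ^ 2 - 1) fun _ => by fun_prop
  have hYint : ∀ t : ℝ, Integrable (fun ω => Real.exp (t * (∑ i, Y i) ω)) μ := fun t =>
    hYind.integrable_exp_mul_sum hYm fun i _ => integrable_exp_mul_sq_of_bounded (hX i) (hB i) t 1
  -- The minimiser of `-θ ε + 48 κ⁴ θ²`, the Chernoff exponent per sample.
  set θ := ε / (96 * κ ^ 4) with hθ
  have hθ0 : 0 ≤ θ := by positivity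
  have hθle : θ ≤ 1 / (2 * κ ^ 2) := by
    rw [hθ, div_le_div_iff₀ (by positivity) (by positivity)]
    have : 1 ≤ κ ^ 2 := by nlinarith
    nlinarith [sq_nonneg (κ ^ 2)]
  have hmgf : ∀ t : ℝ, |t| = θ → mgf (∑ i, Y i) μ t ≤ Real.exp (m * (48 * κ ^ 4 * θ ^ 2)) := by
    intro t ht
    rw [hYind.mgf_sum hYm]
    calc ∏ i, mgf (Y i) μ t ≤ ∏ _i : Fin m, Real.exp (48 * κ ^ 4 * θ ^ 2) := by
          refine Finset.prod_le_prod (fun i _ => mgf_nonneg) fun i _ => ?_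
          rw [← ht, sq_abs]
          exact mgf_sq_sub_one_le (hX i) (hB i) hκ (hvar i) (hexp i) (ht.trans_le hθle)
      _ = _ := by rw [Finset.prod_const, ← Real.exp_nat_mul]; simp
  have hval : Real.exp (-θ * (m * ε)) * Real.exp (m * (48 * κ ^ 4 * θ ^ 2)) =
      Real.exp (-(m * ε ^ 2 / (192 * κ ^ 4))) := by
    rw [← Real.exp_add, hθ]
    congr 1
    field_simp
    ring
  have hup := (measure_ge_le_exp_mul_mgf (m * ε) hθ0 (hYint θ)).trans
    (mul_le_mul_of_nonneg_left (hmgf θ (abs_of_nonneg hθ0)) (Real.exp_pos _).le)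
  have hlo := (measure_le_le_exp_mul_mgf (-(m * ε)) (neg_nonpos.mpr hθ0) (hYint (-θ))).trans
    (mul_le_mul_of_nonneg_left (hmgf (-θ) (by rw [abs_neg, abs_of_nonneg hθ0])) (Real.exp_pos _).le)
  rw [show - -θ * -(m * ε) = -θ * (m * ε) by ring] at hlo
  rw [hval] at hup hlo
  calc _ ≤ μ.real ({ω | m * ε ≤ (∑ i, Y i) ω} ∪ {ω | (∑ i, Y i) ω ≤ -(m * ε)}) := by
        refine measureReal_mono fun ω hω => ?_
        simp only [Set.mem_ofPred_eq] at hω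
        have hs : (∑ i, Y i) ω = m * (1 / (m : ℝ) * ∑ i, X i ω ^ 2 - 1) := by
          simp only [hY, Finset.sum_apply, Finset.sum_sub_distrib]
          field_simp
          simp
        simp only [Set.mem_union, Set.mem_ofPred_eq, hs]
        rcases lt_abs.mp hω with h | h
        · left; gcongr
        · right
          rw [← mul_neg]
          gcongr
          linarith
    _ ≤ _ := measureReal_union_le _ _
    _ ≤ _ := by linarith

end Bernstein

theorem IsIsotropic.integral_inner_sq {Ω : Type u} [MeasurableSpace Ω] {μ : Measure Ω}
    [IsProbabilityMeasure μ] {N : ℕ} {v : Ω → EuclideanSpace ℝ (Fin N)} {B : ℝ}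
    (hv : IsIsotropic μ v) (hmeas : Measurable v) (hB : ∀ᵐ ω ∂μ, ‖v ω‖ ≤ B)
    (w : EuclideanSpace ℝ (Fin N)) : ∫ ω, inner ℝ w (v ω) ^ 2 ∂μ = ‖w‖ ^ 2 := by
  have hint : ∀ p q, Integrable (fun ω => v ω p * v ω q) μ := by
    intro p q
    refine Integrable.of_bound (by fun_prop) (B * B) ?_
    filter_upwards [hB] with ω hω
    rw [norm_mul]
    have hp := (PiLp.norm_apply_le (v ω) p).trans hω
    have hq := (PiLp.norm_apply_le (v ω) q).trans hω
    exact mul_le_mul hp hq (norm_nonneg _) ((norm_nonneg _).trans hp)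
  have hexpand : ∀ ω, inner ℝ w (v ω) ^ 2 = ∑ p, ∑ q, w p * w q * (v ω p * v ω q) := by
    intro ω
    rw [PiLp.inner_apply, sq, Finset.sum_mul_sum]
    refine Finset.sum_congr rfl fun p _ => Finset.sum_congr rfl fun q _ => ?_
    simp
    ring
  simp_rw [hexpand]
  rw [integral_finsetSum _ fun p _ => integrable_finsetSum _ fun q _ => (hint p q).const_mul _]
  simp_rw [integral_finsetSum _ fun q _ => (hint _ q).const_mul _, integral_const_mul, hv _ _]
  rw [EuclideanSpace.norm_sq_eq]
  simp [← sq]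

/-- The empirical second moment of independent isotropic sub-Gaussian vectors in one direction. -/
theorem measure_mean_inner_sq_sub_norm_sq_gt_le {Ω : Type u} [MeasurableSpace Ω] {μ : Measure Ω}
    [IsProbabilityMeasure μ] {m N : ℕ} (hm : 0 < m) {v : Fin m → Ω → EuclideanSpace ℝ (Fin N)}
    {B K κ ε : ℝ} (hmeas : ∀ i, Measurable (v i)) (hind : iIndepFun v μ)
    (hiso : ∀ i, IsIsotropic μ (v i)) (hK : ∀ i, vecPsiTwoNorm μ (v i) ≤ ENNReal.ofReal K)
    (hB : ∀ i, ∀ᵐ ω ∂μ, ‖v i ω‖ ≤ B) (hκ : 1 ≤ κ) (hlt : K < κ) (hε : 0 ≤ ε) (hε1 : ε ≤ 1)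
    (w : EuclideanSpace ℝ (Fin N)) :
    μ.real {ω | ε * ‖w‖ ^ 2 < |1 / (m : ℝ) * ∑ i, inner ℝ (v i ω) w ^ 2 - ‖w‖ ^ 2|} ≤
      2 * Real.exp (-(m * ε ^ 2 / (192 * κ ^ 4))) := by
  rcases eq_or_ne w 0 with rfl | hw
  · simp
    positivity
  have hw0 : 0 < ‖w‖ := norm_pos_iff.mpr hw
  set w' : EuclideanSpace ℝ (Fin N) := ‖w‖⁻¹ • w with hw'
  have hn : ‖w'‖ = 1 := by rw [hw', norm_smul, norm_inv, norm_norm, inv_mul_cancel₀ hw0.ne']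
  have hww : w = ‖w‖ • w' := by rw [hw', smul_smul, mul_inv_cancel₀ hw0.ne', one_smul]
  have key := measure_abs_mean_sq_sub_one_gt_le (μ := μ) hm (X := fun i ω => inner ℝ w' (v i ω))
    (B := B) (κ := κ) (ε := ε) (fun i => by have := hmeas i; fun_prop)
    (fun i => by
      filter_upwards [hB i] with ω hω
      refine (abs_real_inner_le_norm _ _).trans ?_
      rwa [hn, one_mul])
    (hind.comp (fun _ y => inner ℝ w' y) fun _ => by fun_prop) hκ
    (fun i => by rw [(hiso i).integral_inner_sq (hmeas i) (hB i), hn, one_pow])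
    (fun i => lintegral_exp_inner_sq_div_le (hK i) (by linarith) hlt hn) hε hε1
  refine le_trans (measureReal_mono fun ω hω => ?_) key
  simp only [Set.mem_ofPred_eq] at hω ⊢
  have e : 1 / (m : ℝ) * ∑ i, inner ℝ (v i ω) w ^ 2 - ‖w‖ ^ 2
      = (1 / (m : ℝ) * ∑ i, inner ℝ w' (v i ω) ^ 2 - 1) * ‖w‖ ^ 2 := by
    have : ∀ i, inner ℝ (v i ω) w ^ 2 = inner ℝ w' (v i ω) ^ 2 * ‖w‖ ^ 2 := by
      intro i
      nth_rewrite 1 [hww]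
      rw [inner_smul_right, real_inner_comm, mul_pow, mul_comm]
    simp_rw [this]
    rw [← Finset.sum_mul]
    ring
  rw [e, abs_mul, abs_of_pos (by positivity : 0 < ‖w‖ ^ 2)] at hω
  exact lt_of_mul_lt_mul_right hω (by positivity)

/-! ### Nets and reduction of restricted isometry to a finite grid. -/

/-- A bilinear form that is small on a `1/4`-net of the unit sphere is small. -/
theorem abs_bilin_le_of_net {E : Type*} [NormedAddCommGroup E] [NormedSpace ℝ E]
    (β : E →ₗ[ℝ] E →ₗ[ℝ] ℝ) (V : Submodule ℝ E) {S : Set E} {ε C : ℝ}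
    (hC : ∀ u ∈ V, ∀ v ∈ V, |β u v| ≤ C * (‖u‖ * ‖v‖)) (hSV : S ⊆ V)
    (hnet : ∀ u ∈ V, ‖u‖ = 1 → ∃ w ∈ S, ‖w‖ ≤ 1 ∧ ‖u - w‖ ≤ 1 / 4)
    (hε : ∀ w ∈ S, ∀ w' ∈ S, ‖w‖ ≤ 1 → ‖w'‖ ≤ 1 → |β w w'| ≤ ε) :
    ∀ u ∈ V, ∀ v ∈ V, |β u v| ≤ 2 * ε * (‖u‖ * ‖v‖) := by
  -- Self-improvement: any bound `C` improves to `ε + C / 2`, whose fixed point is `2 ε`. Iterating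
  -- from the a priori bound replaces an argument with the operator norm.
  have step : ∀ C : ℝ, (∀ u ∈ V, ∀ v ∈ V, |β u v| ≤ C * (‖u‖ * ‖v‖)) →
      ∀ u ∈ V, ∀ v ∈ V, |β u v| ≤ (ε + C / 2) * (‖u‖ * ‖v‖) := by
    intro C hC
    have hunit : ∀ u ∈ V, ∀ v ∈ V, ‖u‖ = 1 → ‖v‖ = 1 → |β u v| ≤ ε + C / 2 := by
      intro u hu v hv hu1 hv1
      have hC0 : 0 ≤ C := by simpa [hu1, hv1] using (abs_nonneg _).trans (hC u hu v hv)
      obtain ⟨w, hwS, hw1, hw⟩ := hnet u hu hu1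
      obtain ⟨w', hwS', hw1', hw'⟩ := hnet v hv hv1
      have h1 : |β (u - w) v| ≤ C * (1 / 4) := by
        refine (hC _ (V.sub_mem hu (hSV hwS)) v hv).trans ?_
        rw [hv1, mul_one]
        gcongr
      have h2 : |β w (v - w')| ≤ C * (1 / 4) := by
        refine (hC w (hSV hwS) _ (V.sub_mem hv (hSV hwS'))).trans ?_
        have : ‖w‖ * ‖v - w'‖ ≤ 1 * (1 / 4) := by gcongr
        gcongr
        linarith
      have e : β u v = β w w' + β (u - w) v + β w (v - w') := by
        simp only [map_sub, LinearMap.sub_apply]; ring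
      rw [e]
      refine (abs_add_three _ _ _).trans ?_
      linarith [hε w hwS w' hwS' hw1 hw1']
    intro u hu v hv
    rcases eq_or_ne u 0 with rfl | hu0
    · simp
    rcases eq_or_ne v 0 with rfl | hv0
    · simp
    have hun : 0 < ‖u‖ := norm_pos_iff.mpr hu0
    have hvn : 0 < ‖v‖ := norm_pos_iff.mpr hv0
    have h := hunit (‖u‖⁻¹ • u) (V.smul_mem _ hu) (‖v‖⁻¹ • v) (V.smul_mem _ hv)
      (norm_smul_inv_norm hu0) (norm_smul_inv_norm hv0)
    have e : β (‖u‖⁻¹ • u) (‖v‖⁻¹ • v) = β u v / (‖u‖ * ‖v‖) := by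
      simp only [map_smul, LinearMap.smul_apply, smul_eq_mul]
      field_simp
    rwa [e, abs_div, abs_of_pos (by positivity : 0 < ‖u‖ * ‖v‖), div_le_iff₀ (by positivity)] at h
  have iter : ∀ n : ℕ, ∀ u ∈ V, ∀ v ∈ V,
      |β u v| ≤ (2 * ε + (C - 2 * ε) * (1 / 2) ^ n) * (‖u‖ * ‖v‖) := by
    intro n
    induction n with
    | zero => simpa using hC
    | succ n ih =>
      have := step _ ih
      intro u hu v hv
      refine (this u hu v hv).trans (le_of_eq ?_)
      ring
  intro u hu v hv
  have hlim : Filter.Tendsto (fun n : ℕ => (2 * ε + (C - 2 * ε) * (1 / 2 : ℝ) ^ n) * (‖u‖ * ‖v‖))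
      Filter.atTop (nhds ((2 * ε + (C - 2 * ε) * 0) * (‖u‖ * ‖v‖))) :=
    ((((tendsto_pow_atTop_nhds_zero_of_lt_one (by norm_num) (by norm_num)).const_mul _).const_add
      _).mul_const _)
  rw [mul_zero, add_zero] at hlim
  exact ge_of_tendsto' hlim fun n => iter n u hu v hv

/-- The vector with coordinates `z i / (4 d)`. -/
noncomputable def gridVec {N : ℕ} (d : ℕ) (z : Fin N → ℤ) : EuclideanSpace ℝ (Fin N) :=
  WithLp.toLp 2 fun i => (z i : ℝ) / (4 * d)

/-- Integer vectors supported on `S` with entries of size at most `R`. -/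
noncomputable def intBox {N : ℕ} (S : Finset (Fin N)) (R : ℕ) : Finset (Fin N → ℤ) :=
  Fintype.piFinset fun i => if i ∈ S then Finset.Icc (-(R : ℤ)) R else {0}

theorem mem_intBox {N : ℕ} {S : Finset (Fin N)} {R : ℕ} {z : Fin N → ℤ} :
    z ∈ intBox S R ↔ (∀ i ∉ S, z i = 0) ∧ ∀ i, |z i| ≤ R := by
  simp only [intBox, Fintype.mem_piFinset]
  refine ⟨fun h => ⟨fun i hi => by simpa [hi] using h i, fun i => ?_⟩, fun h i => ?_⟩
  · have := h i
    split_ifs at this with hi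
    · exact abs_le.mpr (Finset.mem_Icc.mp this)
    · simp [Finset.mem_singleton.mp this]
  · split_ifs with hi
    · exact Finset.mem_Icc.mpr (abs_le.mp (h.2 i))
    · exact Finset.mem_singleton.mpr (h.1 i hi)

theorem card_intBox {N : ℕ} (S : Finset (Fin N)) (R : ℕ) :
    (intBox S R).card = (2 * R + 1) ^ S.card := by
  have h : ∀ i, (if i ∈ S then Finset.Icc (-(R : ℤ)) R else {0}).card
      = if i ∈ S then 2 * R + 1 else 1 := by
    intro i
    split_ifs
    · simp; omega
    · simp
  rw [intBox, Fintype.card_piFinset]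
  simp_rw [h]
  rw [Finset.prod_ite_mem]
  simp

/-- Rounding toward zero, rather than to the nearest integer, keeps grid points in the unit ball. -/
theorem exists_int_round_toward_zero (t : ℝ) : ∃ z : ℤ, |(z : ℝ)| ≤ |t| ∧ |t - z| ≤ 1 := by
  rcases le_total 0 t with ht | ht
  · refine ⟨⌊t⌋, ?_, ?_⟩
    · have : (0 : ℝ) ≤ ⌊t⌋ := by exact_mod_cast Int.floor_nonneg.mpr ht
      rw [abs_of_nonneg this, abs_of_nonneg ht]
      exact Int.floor_le t
    · rw [abs_le]
      constructor <;> linarith [Int.floor_le t, Int.lt_floor_add_one t]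
  · refine ⟨⌈t⌉, ?_, ?_⟩
    · have : (⌈t⌉ : ℝ) ≤ 0 := by exact_mod_cast Int.ceil_le.mpr (by simpa using ht)
      rw [abs_of_nonpos this, abs_of_nonpos ht]
      linarith [Int.le_ceil t]
    · rw [abs_le]
      constructor <;> linarith [Int.le_ceil t, Int.ceil_lt_add_one t]

/-- Each of the `d` coordinates moves by at most `1 / (4 d)`, so the distance is at most `1 / (4
√d)`. -/
theorem exists_gridVec_near {N d : ℕ} (hd : 0 < d) {S : Finset (Fin N)} (hS : S.card = d)
    {u : EuclideanSpace ℝ (Fin N)} (hu : ∀ i ∉ S, u i = 0) (hu1 : ‖u‖ = 1) :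
    ∃ z ∈ intBox S (4 * d), ‖gridVec d z‖ ≤ 1 ∧ ‖u - gridVec d z‖ ≤ 1 / 4 := by
  have hd' : (0 : ℝ) < d := by exact_mod_cast hd
  choose z hz1 hz2 using fun i => exists_int_round_toward_zero (u i * (4 * d))
  have hle : ∀ i, |(z i : ℝ)| ≤ |u i| * (4 * d) := by
    intro i
    have := hz1 i
    rwa [abs_mul, abs_of_pos (by positivity : (0 : ℝ) < 4 * d)] at this
  have hoff : ∀ i ∉ S, z i = 0 := by
    intro i hi
    have := hle i
    rw [hu i hi, abs_zero, zero_mul] at this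
    exact_mod_cast abs_nonpos_iff.mp this
  refine ⟨z, mem_intBox.mpr ⟨hoff, fun i => ?_⟩, ?_, ?_⟩
  · have h1 : |u i| ≤ 1 := by
      have := PiLp.norm_apply_le u i
      rwa [hu1] at this
    have : |(z i : ℝ)| ≤ 4 * d := (hle i).trans (by nlinarith)
    exact_mod_cast this
  · rw [← hu1, EuclideanSpace.norm_eq, EuclideanSpace.norm_eq]
    gcongr with i
    simp only [gridVec, Real.norm_eq_abs]
    rw [abs_div, abs_of_pos (by positivity : (0 : ℝ) < 4 * d), div_le_iff₀ (by positivity)]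
    exact hle i
  · apply le_of_sq_le_sq _ (by norm_num)
    rw [EuclideanSpace.norm_sq_eq]
    calc ∑ i, ‖(u - gridVec d z) i‖ ^ 2 ≤ ∑ i, if i ∈ S then (1 / (4 * d : ℝ)) ^ 2 else 0 := by
          refine Finset.sum_le_sum fun i _ => ?_
          split_ifs with hi
          · gcongr
            have : (u - gridVec d z) i = (u i * (4 * d) - z i) / (4 * d) := by
              simp only [gridVec, PiLp.sub_apply]
              field_simp
            rw [this, Real.norm_eq_abs, abs_div, abs_of_pos (by positivity : (0 : ℝ) < 4 * d)]
            gcongr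
            exact hz2 i
          · simp [gridVec, hu i hi, hoff i hi]
      _ = d * (1 / (4 * d : ℝ)) ^ 2 := by
          rw [Finset.sum_ite_mem]
          simp [hS]
      _ = 1 / (16 * d) := by field_simp; norm_num
      _ ≤ (1 / 4) ^ 2 := by
          rw [div_le_iff₀ (by positivity)]
          have : (1 : ℝ) ≤ d := by exact_mod_cast hd
          linarith

theorem gridVec_add {N : ℕ} (d : ℕ) (z z' : Fin N → ℤ) :
    gridVec d (z + z') = gridVec d z + gridVec d z' := by
  ext i; simp [gridVec, add_div]

theorem gridVec_sub {N : ℕ} (d : ℕ) (z z' : Fin N → ℤ) :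
    gridVec d (z - z') = gridVec d z - gridVec d z' := by
  ext i; simp [gridVec, sub_div]

/-- The bilinear form of `Aᵀ A / m - 1`. -/
noncomputable def gramDefect {m N : ℕ} (A : Matrix (Fin m) (Fin N) ℝ) :
    EuclideanSpace ℝ (Fin N) →ₗ[ℝ] EuclideanSpace ℝ (Fin N) →ₗ[ℝ] ℝ :=
  LinearMap.mk₂ ℝ (fun u v =>
      1 / m * ∑ i, inner ℝ (euclRow A i) u * inner ℝ (euclRow A i) v - inner ℝ u v)
    (fun u u' v => by simp only [inner_add_right, inner_add_left, add_mul, Finset.sum_add_distrib]; ring)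
    (fun c u v => by
      simp only [inner_smul_right, real_inner_smul_left, mul_assoc, ← Finset.mul_sum, smul_eq_mul]
      ring)
    (fun u v v' => by simp only [inner_add_right, mul_add, Finset.sum_add_distrib]; ring)
    (fun c u v => by
      simp only [inner_smul_right, mul_left_comm _ c, ← Finset.mul_sum, smul_eq_mul]
      ring)

theorem gramDefect_apply {m N : ℕ} (A : Matrix (Fin m) (Fin N) ℝ)
    (u v : EuclideanSpace ℝ (Fin N)) : gramDefect A u v =
      1 / m * ∑ i, inner ℝ (euclRow A i) u * inner ℝ (euclRow A i) v - inner ℝ u v := rfl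

theorem gramDefect_comm {m N : ℕ} (A : Matrix (Fin m) (Fin N) ℝ)
    (u v : EuclideanSpace ℝ (Fin N)) : gramDefect A u v = gramDefect A v u := by
  rw [gramDefect_apply, gramDefect_apply, real_inner_comm]
  simp_rw [mul_comm (inner ℝ (euclRow A _) u)]

theorem gramDefect_self {m N : ℕ} (A : Matrix (Fin m) (Fin N) ℝ) (u : EuclideanSpace ℝ (Fin N)) :
    gramDefect A u u = 1 / m * ∑ i, inner ℝ (euclRow A i) u ^ 2 - ‖u‖ ^ 2 := by
  rw [gramDefect_apply, real_inner_self_eq_norm_sq]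
  simp_rw [sq]

theorem abs_gramDefect_le {m N : ℕ} (A : Matrix (Fin m) (Fin N) ℝ)
    (u v : EuclideanSpace ℝ (Fin N)) :
    |gramDefect A u v| ≤ (1 / m * ∑ i, ‖euclRow A i‖ ^ 2 + 1) * (‖u‖ * ‖v‖) := by
  rw [gramDefect_apply, add_mul, one_mul]
  refine (abs_sub _ _).trans (add_le_add ?_ (abs_real_inner_le_norm _ _))
  rw [abs_mul, abs_of_nonneg (by positivity : (0 : ℝ) ≤ 1 / m), mul_assoc, Finset.sum_mul]
  gcongr
  refine (Finset.abs_sum_le_sum_abs _ _).trans ?_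
  gcongr with i
  rw [abs_mul]
  calc _ ≤ (‖euclRow A i‖ * ‖u‖) * (‖euclRow A i‖ * ‖v‖) := by
        gcongr <;> exact abs_real_inner_le_norm _ _
    _ = _ := by ring

/-- Polarisation turns the quadratic bound into a bilinear one on the net. Sums and differences of
net points have entries up to `8 d`, hence the larger box; the passage from net to subspace doubles
`ε`. -/
theorem hasRIP_of_grid {m N d : ℕ} {A : Matrix (Fin m) (Fin N) ℝ} {ε : ℝ} (hε : 0 ≤ ε) (hd : 0 < d)
    (hdN : d ≤ N) (h : ∀ S ∈ Finset.powersetCard d (Finset.univ : Finset (Fin N)),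
      ∀ z ∈ intBox S (8 * d),
        |gramDefect A (gridVec d z) (gridVec d z)| ≤ ε * ‖gridVec d z‖ ^ 2) :
    HasRIP A d (2 * ε) := by
  intro S₀ hS₀ u v hu hv
  obtain ⟨S, hSS, hS⟩ := Finset.exists_superset_card_eq hS₀ (by simpa using hdN)
  let V : Submodule ℝ (EuclideanSpace ℝ (Fin N)) :=
    { carrier := {u | ∀ i ∉ S, u i = 0}
      add_mem' := fun {a b} ha hb i hi => by simp [ha i hi, hb i hi]
      zero_mem' := fun i _ => rfl
      smul_mem' := fun c a ha i hi => by simp [ha i hi] }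
  have hV : ∀ u, u ∈ V ↔ ∀ i ∉ S, u i = 0 := fun u => Iff.rfl
  have hS' : S ∈ Finset.powersetCard d (Finset.univ : Finset (Fin N)) := by simp [hS]
  refine abs_bilin_le_of_net (gramDefect A) V (S := gridVec d '' (intBox S (4 * d))) (ε := ε)
    (fun u _ v _ => abs_gramDefect_le A u v) ?_ ?_ ?_ u ?_ v ?_
  · rintro _ ⟨z, hz, rfl⟩ i hi
    simp [gridVec, (mem_intBox.mp hz).1 i hi]
  · intro u hu hu1
    obtain ⟨z, hz, h1, h2⟩ := exists_gridVec_near hd hS hu hu1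
    exact ⟨_, ⟨z, hz, rfl⟩, h1, h2⟩
  · rintro _ ⟨z, hz, rfl⟩ _ ⟨z', hz', rfl⟩ h1 h2
    rw [Finset.mem_coe, mem_intBox] at hz hz'
    have hadd := h S hS' (z + z') (mem_intBox.mpr ⟨fun i hi => by simp [hz.1 i hi, hz'.1 i hi],
      fun i => (abs_add_le _ _).trans (by
        have := hz.2 i; have := hz'.2 i; push_cast at *; linarith)⟩)
    have hsub := h S hS' (z - z') (mem_intBox.mpr ⟨fun i hi => by simp [hz.1 i hi, hz'.1 i hi],
      fun i => (abs_sub _ _).trans (by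
        have := hz.2 i; have := hz'.2 i; push_cast at *; linarith)⟩)
    rw [gridVec_add] at hadd
    rw [gridVec_sub] at hsub
    set a := gridVec d z
    set b := gridVec d z'
    have e : gramDefect A a b =
        (gramDefect A (a + b) (a + b) - gramDefect A (a - b) (a - b)) / 4 := by
      simp only [map_add, map_sub, LinearMap.add_apply, LinearMap.sub_apply]
      rw [gramDefect_comm A b a]
      ring
    -- It bounds `‖a + b‖² + ‖a - b‖²` by 4, which cancels the 4 of polarisation.
    have hpar := parallelogram_law_with_norm ℝ a b
    have ha : ‖a‖ * ‖a‖ ≤ 1 := mul_le_one₀ h1 (norm_nonneg _) h1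
    have hb : ‖b‖ * ‖b‖ ≤ 1 := mul_le_one₀ h2 (norm_nonneg _) h2
    rw [e, abs_div, abs_of_pos (by norm_num : (0 : ℝ) < 4), div_le_iff₀ (by norm_num)]
    refine (abs_sub _ _).trans ((add_le_add hadd hsub).trans ?_)
    rw [← mul_add]
    gcongr
    linarith
  · exact fun i hi => hu i fun hc => hi (hSS hc)
  · exact fun i hi => hv i fun hc => hi (hSS hc)

/-! ### Restricted isometry of random matrices. -/

/-- Supports never exceed `N` elements; this covers the case `3 s > N`. -/
theorem HasRIP.of_le_of_card_le {m N d d' : ℕ} {A : Matrix (Fin m) (Fin N) ℝ} {δ : ℝ}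
    (hA : HasRIP A (min d N) δ) (hd : d' ≤ d) : HasRIP A d' δ :=
  fun S hS => hA S (le_min (hS.trans hd) (by simpa using Finset.card_le_univ S))

/-- Random matrices with independent isotropic sub-Gaussian rows have the restricted isometry
property with high probability. -/
theorem exists_measurableSet_hasRIP {Ω : Type u} [MeasurableSpace Ω] {μ : Measure Ω}
    [IsProbabilityMeasure μ] {m N d : ℕ} (hm : 0 < m) (hd : 0 < d) (hdN : d ≤ N)
    {A : Ω → Matrix (Fin m) (Fin N) ℝ} {r K κ ε : ℝ}
    (hmeas : ∀ i, Measurable fun ω => euclRow (A ω) i)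
    (hind : iIndepFun (fun i ω => euclRow (A ω) i) μ)
    (hiso : ∀ i, IsIsotropic μ fun ω => euclRow (A ω) i)
    (hK : ∀ i, vecPsiTwoNorm μ (fun ω => euclRow (A ω) i) ≤ ENNReal.ofReal K)
    (hrow : ∀ i, ∀ᵐ ω ∂μ, ‖euclRow (A ω) i‖ = r) (hκ : 1 ≤ κ) (hlt : K < κ)
    (hε : 0 ≤ ε) (hε1 : ε ≤ 1) :
    ∃ E : Set Ω, MeasurableSet E ∧
      1 - (N : ℝ) ^ d * (16 * d + 1) ^ d * (2 * Real.exp (-(m * ε ^ 2 / (192 * κ ^ 4))))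
        ≤ μ.real E ∧
      ∀ ω ∈ E, HasRIP (A ω) d (2 * ε) ∧ ∀ i, ‖euclRow (A ω) i‖ = r := by
  let P := Finset.powersetCard d (Finset.univ : Finset (Fin N))
  let bad : (Fin N → ℤ) → Set Ω := fun z =>
    {ω | ε * ‖gridVec d z‖ ^ 2 < |1 / (m : ℝ) * ∑ i, inner ℝ (euclRow (A ω) i) (gridVec d z) ^ 2
      - ‖gridVec d z‖ ^ 2|}
  let U : Set Ω := ⋃ S ∈ P, ⋃ z ∈ intBox S (8 * d), bad z
  have hbad : ∀ z, MeasurableSet (bad z) := fun z =>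
    measurableSet_lt measurable_const (by fun_prop)
  have hU : MeasurableSet U := Finset.measurableSet_biUnion _ fun S _ =>
    Finset.measurableSet_biUnion _ fun z _ => hbad z
  have hUle : μ.real U ≤
      (N : ℝ) ^ d * (16 * d + 1) ^ d * (2 * Real.exp (-(m * ε ^ 2 / (192 * κ ^ 4)))) := by
    set p := 2 * Real.exp (-(m * ε ^ 2 / (192 * κ ^ 4))) with hp
    calc μ.real U ≤ ∑ S ∈ P, μ.real (⋃ z ∈ intBox S (8 * d), bad z) :=
          measureReal_biUnion_finset_le _ _
      _ ≤ ∑ S ∈ P, ∑ z ∈ intBox S (8 * d), μ.real (bad z) := by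
          gcongr with S hS
          exact measureReal_biUnion_finset_le _ _
      _ ≤ ∑ S ∈ P, ∑ z ∈ intBox S (8 * d), p := by
          gcongr with S hS z hz
          exact measure_mean_inner_sq_sub_norm_sq_gt_le hm hmeas hind hiso hK
            (fun i => (hrow i).mono fun ω h => h.le) hκ hlt hε hε1 _
      _ = ∑ S ∈ P, (16 * d + 1 : ℝ) ^ d * p := by
          refine Finset.sum_congr rfl fun S hS => ?_
          rw [Finset.sum_const, card_intBox, (Finset.mem_powersetCard.mp hS).2, nsmul_eq_mul]
          push_cast
          ring
      _ = (N.choose d : ℝ) * ((16 * d + 1 : ℝ) ^ d * p) := by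
          rw [Finset.sum_const, nsmul_eq_mul, Finset.card_powersetCard]
          simp
      _ ≤ (N : ℝ) ^ d * ((16 * d + 1 : ℝ) ^ d * p) := by
          have : (N.choose d : ℝ) ≤ (N : ℝ) ^ d := by exact_mod_cast Nat.choose_le_pow N d
          gcongr
      _ = _ := by ring
  let G : Set Ω := {ω | ∀ i, ‖euclRow (A ω) i‖ = r}
  have hG : MeasurableSet G := by
    have : G = ⋂ i, {ω | ‖euclRow (A ω) i‖ = r} := by ext; simp [G]
    rw [this]
    exact MeasurableSet.iInter fun i => measurableSet_eq_fun (hmeas i).norm measurable_const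
  refine ⟨Uᶜ ∩ G, hU.compl.inter hG, ?_, ?_⟩
  · have hae : (Uᶜ ∩ G : Set Ω) =ᵐ[μ] Uᶜ := by
      filter_upwards [ae_all_iff.mpr hrow] with ω hω
      exact propext ⟨fun h => h.1, fun h => ⟨h, hω⟩⟩
    have h1 : μ.real (Uᶜ ∩ G) = μ.real Uᶜ := measureReal_congr hae
    have h2 : μ.real Uᶜ = 1 - μ.real U := probReal_compl_eq_one_sub hU
    linarith
  · rintro ω ⟨hω, hωG⟩
    refine ⟨hasRIP_of_grid hε hd hdN fun S hS z hz => ?_, hωG⟩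
    by_contra! hc
    rw [gramDefect_self] at hc
    exact hω (Set.mem_biUnion hS (Set.mem_biUnion hz hc))

/-! ### Choice of constants and assembly. -/

/-- The sub-Gaussian norm of an isotropic vector is bounded below. -/
theorem half_le_of_isIsotropic_of_vecPsiTwoNorm_le {Ω : Type u} [MeasurableSpace Ω] {μ : Measure Ω}
    [IsProbabilityMeasure μ] {N : ℕ} (hN : 0 < N) {v : Ω → EuclideanSpace ℝ (Fin N)} {B K : ℝ}
    (hiso : IsIsotropic μ v) (hmeas : Measurable v) (hB : ∀ᵐ ω ∂μ, ‖v ω‖ ≤ B)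
    (hK : vecPsiTwoNorm μ v ≤ ENNReal.ofReal K) : 1 / 2 ≤ K := by
  by_contra! hlt
  set w : EuclideanSpace ℝ (Fin N) := EuclideanSpace.single ⟨0, hN⟩ 1
  have hw : ‖w‖ = 1 := by simp [w]
  have hexp := lintegral_exp_inner_sq_div_le hK (by norm_num : (0 : ℝ) < 1 / 2) hlt hw
  have hvar := hiso.integral_inner_sq hmeas hB w
  rw [hw, one_pow] at hvar
  have hint : Integrable (fun ω => inner ℝ w (v ω) ^ 2) μ := by
    by_contra hc
    rw [integral_undef hc] at hvar
    exact zero_ne_one hvar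
  have h4 : ∫ ω, 4 * inner ℝ w (v ω) ^ 2 ∂μ = 4 := by rw [integral_const_mul, hvar, mul_one]
  -- For a unit marginal X, 4 = E 4X² ≤ E exp(4X²) ≤ 2, which is absurd.
  have hle : ENNReal.ofReal 4 ≤ 2 := by
    rw [← h4, ofReal_integral_eq_lintegral_ofReal (hint.const_mul 4)
      (ae_of_all _ fun ω => by positivity)]
    refine le_trans (lintegral_mono fun ω => ENNReal.ofReal_le_ofReal ?_) hexp
    have e : inner ℝ w (v ω) ^ 2 / (1 / 2 : ℝ) ^ 2 = 4 * inner ℝ w (v ω) ^ 2 := by ring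
    rw [e]
    linarith [Real.add_one_le_exp (4 * inner ℝ w (v ω) ^ 2)]
  rw [show (2 : ℝ≥0∞) = ENNReal.ofReal 2 by simp,
    ENNReal.ofReal_le_ofReal_iff zero_le_two] at hle
  norm_num at hle

/-- The entropy of the grid of `3 s`-sparse vectors is dominated by the logarithmic oversampling. -/
theorem grid_card_mul_exp_le {N s d : ℕ} {t ℓ₀ K : ℝ} (hs : 1 ≤ s) (hsN : s ≤ N) (hd : d ≤ 3 * s)
    (hK : 0 < K) (hℓ₀ : 0 < ℓ₀) (hℓ : ℓ₀ ≤ Real.log (N / s)) (hst : Real.log s ≤ t) (ht : 1 ≤ t)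
    (ht1 : 18 * 16384 * K ^ 2 / ℓ₀ ≤ t) (ht2 : 3 * 16384 * K ^ 2 ≤ t) :
    (N : ℝ) ^ d * (16 * d + 1) ^ d *
        (2 * Real.exp (-(s * Real.log (N / s) * t ^ 2 / (4096 * K ^ 2))))
      ≤ 2 * Real.exp (-(ℓ₀ / (8192 * K ^ 2)) * t ^ 2) := by
  set ℓ := Real.log (N / s) with hℓdef
  have hs' : (1 : ℝ) ≤ s := by exact_mod_cast hs
  have hs0 : (0 : ℝ) < s := by linarith
  have hN0 : (0 : ℝ) < N := by exact_mod_cast (by omega : 0 < N)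
  have hN1 : (1 : ℝ) ≤ N := by exact_mod_cast (by omega : 1 ≤ N)
  have hd' : (d : ℝ) ≤ 3 * s := by exact_mod_cast hd
  have hℓ0 : 0 < ℓ := hℓ₀.trans_le hℓ
  -- Since `N = s exp ℓ`, the dimension costs only `log s + ℓ`; 49 comes from `16 d + 1 ≤ 48 s + 1`.
  have hlog : Real.log (N * (49 * s)) ≤ 4 + 2 * t + ℓ := by
    have e : Real.log (N * (49 * s)) = Real.log 49 + 2 * Real.log s + ℓ := by
      rw [hℓdef, Real.log_div hN0.ne' hs0.ne', Real.log_mul hN0.ne' (by positivity),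
        Real.log_mul (by norm_num) hs0.ne']
      ring
    have h49 : Real.log 49 ≤ 4 := by
      rw [Real.log_le_iff_le_exp (by norm_num)]
      have h1 : (2.7 : ℝ) ≤ Real.exp 1 := by linarith [Real.exp_one_gt_d9]
      have h2 : Real.exp 4 = Real.exp 1 ^ 4 := by rw [← Real.exp_nat_mul]; norm_num
      rw [h2]
      calc (49 : ℝ) ≤ 2.7 ^ 4 := by norm_num
        _ ≤ _ := by gcongr
    rw [e]
    linarith
  have hcount : (N : ℝ) ^ d * (16 * d + 1) ^ d ≤ Real.exp (3 * s * (4 + 2 * t + ℓ)) := by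
    calc (N : ℝ) ^ d * (16 * d + 1) ^ d = (N * (16 * d + 1)) ^ d := by rw [mul_pow]
      _ ≤ (N * (49 * s)) ^ d := by gcongr; linarith
      _ ≤ (N * (49 * s)) ^ (3 * s) := by
          refine pow_le_pow_right₀ ?_ hd
          nlinarith
      _ = Real.exp (3 * s * Real.log (N * (49 * s))) := by
          rw [← Real.exp_log (by positivity : (0 : ℝ) < N * (49 * s)), ← Real.exp_nat_mul,
            Real.log_exp]
          push_cast
          ring_nf
      _ ≤ _ := by gcongr
  -- The entropy may use half of the Bernstein exponent; the other half is left for the probability.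
  have hmain : 3 * (4 + 2 * t + ℓ) ≤ ℓ * t ^ 2 / (8192 * K ^ 2) := by
    have h1 : 18 * t ≤ ℓ * t ^ 2 / (16384 * K ^ 2) := by
      rw [le_div_iff₀ (by positivity)]
      rw [div_le_iff₀ hℓ₀] at ht1
      have : 18 * 16384 * K ^ 2 ≤ t * ℓ := ht1.trans (by gcongr)
      nlinarith
    have h2 : 3 * ℓ ≤ ℓ * t ^ 2 / (16384 * K ^ 2) := by
      rw [le_div_iff₀ (by positivity)]
      have : 3 * 16384 * K ^ 2 ≤ t ^ 2 := by nlinarith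
      nlinarith
    have e : ℓ * t ^ 2 / (8192 * K ^ 2) =
        ℓ * t ^ 2 / (16384 * K ^ 2) + ℓ * t ^ 2 / (16384 * K ^ 2) := by
      field_simp; norm_num
    linarith
  have hfin : ℓ₀ / (8192 * K ^ 2) * t ^ 2 ≤ s * (ℓ * t ^ 2 / (8192 * K ^ 2)) := by
    calc ℓ₀ / (8192 * K ^ 2) * t ^ 2 ≤ ℓ / (8192 * K ^ 2) * t ^ 2 := by gcongr
      _ = 1 * (ℓ * t ^ 2 / (8192 * K ^ 2)) := by ring
      _ ≤ _ := by gcongr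
  calc _ ≤ Real.exp (3 * s * (4 + 2 * t + ℓ)) *
        (2 * Real.exp (-(s * ℓ * t ^ 2 / (4096 * K ^ 2)))) := by gcongr
    _ = 2 * Real.exp (3 * s * (4 + 2 * t + ℓ) - s * ℓ * t ^ 2 / (4096 * K ^ 2)) := by
        rw [sub_eq_add_neg, Real.exp_add]; ring
    _ ≤ _ := by
        gcongr
        have e : s * ℓ * t ^ 2 / (4096 * K ^ 2) = 2 * (s * (ℓ * t ^ 2 / (8192 * K ^ 2))) := by
          field_simp; norm_num
        have := mul_le_mul_of_nonneg_left hmain hs0.le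
        rw [e]
        nlinarith

theorem theorem3p2 :
    ∃ C₀ : ℝ, 0 < C₀ ∧ ∀ ρ : ℝ, 0 < ρ → ρ < 1 → ∀ K : ℝ, 0 < K →
    ∃ C₁ C₂ : ℝ, 0 < C₁ ∧ 0 < C₂ ∧
    ∀ (m N s : ℕ) (δ γ lam : ℝ), 1 ≤ s → (s : ℝ) ≤ ρ * (N : ℝ) →
      δ = √(3 * s * Real.log (N / s) * (K * Real.log m) ^ 2 / m) → δ < 1 / 4 →
      γ = δ / (2 * m * (K * Real.log m) ^ 2 * √(N : ℝ)) →
      lam = 2 * (N : ℝ) ^ (3 / 2 : ℝ) * (K * Real.log m) ^ 2 / δ →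
      C₁ * s * Real.log (N / s) * (K * Real.log m) ^ 2 ≤ m →
    ∀ (Ω : Type u) [MeasurableSpace Ω] (μ : Measure Ω) [IsProbabilityMeasure μ]
      (A : Ω → Matrix (Fin m) (Fin N) ℝ),
      (∀ i, Measurable fun ω => euclRow (A ω) i) →
      iIndepFun (fun i ω => euclRow (A ω) i) μ →
      (∀ i, ∫ ω, euclRow (A ω) i ∂μ = 0) →
      (∀ i, IsIsotropic μ fun ω => euclRow (A ω) i) →
      (∀ i, vecPsiTwoNorm μ (fun ω => euclRow (A ω) i) ≤ ENNReal.ofReal K) →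
      (∀ i, ∀ᵐ ω ∂μ, ‖euclRow (A ω) i‖ = √(N : ℝ)) →
    ∃ E : Set Ω, MeasurableSet E ∧
      1 - ((m : ℝ) ^ 2 + 2) * Real.exp (-C₂ * Real.log m ^ 2) ≤ μ.real E ∧
      ∀ ω ∈ E, ∀ x : EuclideanSpace ℝ (Fin N), IsSparse s x → ∀ e : Fin m → ℝ,
      ∀ τ : ℕ → Equiv.Perm (Fin m),
      ∀ T : EuclideanSpace ℝ (Fin N) → EuclideanSpace ℝ (Fin N), IsHardThresholding s T →
      ∀ k : ℕ,
        ‖kzpt (A ω) (A ω *ᵥ x.ofLp + e) γ lam T τ k - x‖ ≤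
          (4 * δ) ^ k * ‖kzpt (A ω) (A ω *ᵥ x.ofLp + e) γ lam T τ 0 - x‖
          + 2 / (1 - 4 * δ) *
            (⨆ S : {S : Finset (Fin N) // S.card ≤ 2 * s},
              ‖coordProj S.1 (WithLp.toLp 2 ((1 / (m : ℝ)) • ((A ω)ᵀ *ᵥ e)))‖)
          + C₀ * √(s * Real.log (N / s) / m) * ((∑ i, |e i|) / ((1 - 4 * δ) * m)) := by
  refine ⟨2, two_pos, fun ρ hρ0 hρ1 K hK => ?_⟩
  set ℓ₀ := -Real.log ρ with hℓ₀def
  have hℓ₀ : 0 < ℓ₀ := neg_pos.mpr (Real.log_neg hρ0 hρ1)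
  -- Beyond `Λ`, `log m` is at least 1, `K log m ≥ 2`, and both entropy thresholds are met.
  set Λ : ℝ := 1 + 2 / K + 18 * 16384 * K ^ 2 / ℓ₀ + 3 * 16384 * K ^ 2 with hΛ
  have hp1 : 0 < 2 / K := by positivity
  have hp2 : 0 < 18 * 16384 * K ^ 2 / ℓ₀ := by positivity
  have hp3 : 0 < 3 * 16384 * K ^ 2 := by positivity
  have hΛ0 : 0 < Λ := by linarith
  have hlog2 : 0 < Real.log 2 := Real.log_pos one_lt_two
  -- The value of `C₁` serves to give `s ≤ m`, hence `log s ≤ log m`. In `C₂`, the first entry makes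
  -- the case `log m ≤ Λ` trivial, the second is the Bernstein rate left after entropy.
  refine ⟨1 / ℓ₀, min (Real.log 2 / Λ ^ 2) (ℓ₀ / (8192 * K ^ 2)), by positivity,
    lt_min (by positivity) (by positivity), ?_⟩
  set C₂ := min (Real.log 2 / Λ ^ 2) (ℓ₀ / (8192 * K ^ 2)) with hC₂
  intro m N s δ γ lam hs hsρ hδ hδ4 hγ hlam hm Ω _ μ _ A hmeas hind _ hiso hpsi hrow
  set t := Real.log m with ht
  have ht0 : 0 ≤ t := Real.log_natCast_nonneg m
  -- For `t ≤ Λ` the claimed lower bound on the probability is nonpositive, so the empty event will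
  -- do.
  rcases le_or_gt t Λ with htΛ | htΛ
  · refine ⟨∅, MeasurableSet.empty, ?_, by simp⟩
    rw [measureReal_empty, sub_nonpos]
    have h1 : C₂ * t ^ 2 ≤ Real.log 2 := by
      calc C₂ * t ^ 2 ≤ Real.log 2 / Λ ^ 2 * Λ ^ 2 := by
            gcongr
            exact min_le_left _ _
        _ = Real.log 2 := by field_simp
    have h2 : 1 / 2 ≤ Real.exp (-C₂ * t ^ 2) := by
      calc (1 / 2 : ℝ) = Real.exp (-Real.log 2) := by
            rw [Real.exp_neg, Real.exp_log two_pos, one_div]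
        _ ≤ _ := by gcongr; linarith
    calc (1 : ℝ) = 2 * (1 / 2) := by norm_num
      _ ≤ _ := by
        gcongr
        linarith [sq_nonneg (m : ℝ)]
  have hm0 : 0 < m := by
    rcases Nat.eq_zero_or_pos m with h | h
    · simp [ht, h] at htΛ
      linarith
    · exact h
  have hm' : (0 : ℝ) < m := by exact_mod_cast hm0
  have hs' : (1 : ℝ) ≤ s := by exact_mod_cast hs
  have hs0 : (0 : ℝ) < s := by linarith
  have hN' : (0 : ℝ) < N := by
    by_contra! hc
    linarith [mul_nonpos_of_nonneg_of_nonpos hρ0.le hc]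
  have hN0 : 0 < N := by exact_mod_cast hN'
  have hN1 : (1 : ℝ) ≤ N := by exact_mod_cast hN0
  have hsN : s ≤ N := by
    have : (s : ℝ) ≤ N := hsρ.trans (mul_le_of_le_one_left hN'.le hρ1.le)
    exact_mod_cast this
  set ℓ := Real.log (N / s) with hℓdef
  have hℓ : ℓ₀ ≤ ℓ := by
    rw [hℓ₀def, hℓdef, ← Real.log_inv]
    apply Real.log_le_log (by positivity)
    rw [le_div_iff₀ hs0, inv_mul_le_iff₀ hρ0]
    exact hsρ
  have hℓ0 : 0 < ℓ := hℓ₀.trans_le hℓ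
  have htpos : 0 < t := hΛ0.trans htΛ
  set L := K * t with hL
  have hL2 : 2 ≤ L := by
    have : 2 / K ≤ t := by linarith
    rw [div_le_iff₀ hK] at this
    linarith
  have hLpos : 0 < L := by linarith
  -- This makes `κ = 2 K` admissible: it is at least 1 and exceeds `K`.
  have hhalf : 1 / 2 ≤ K := half_le_of_isIsotropic_of_vecPsiTwoNorm_le hN0 (hiso ⟨0, hm0⟩)
    (hmeas _) ((hrow _).mono fun ω h => h.le) (hpsi _)
  have hδsq : δ ^ 2 = 3 * s * ℓ * L ^ 2 / m := by rw [hδ, Real.sq_sqrt (by positivity)]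
  have hδpos : 0 < δ := by rw [hδ]; positivity
  have hsm : (s : ℝ) ≤ m := by
    refine le_trans ?_ hm
    calc (s : ℝ) = 1 / ℓ₀ * s * ℓ₀ * 1 := by field_simp
      _ ≤ 1 / ℓ₀ * s * ℓ * L ^ 2 := by
        gcongr
        exact one_le_pow₀ (by linarith)
  obtain ⟨E, hE, hEμ, hEgood⟩ := exists_measurableSet_hasRIP (d := min (3 * s) N) (κ := 2 * K)
    (ε := δ / 2) hm0 (lt_min (by omega) hN0) (min_le_right _ _) hmeas hind hiso hpsi hrow
    (by linarith) (by linarith) (by linarith) (by linarith)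
  refine ⟨E, hE, le_trans ?_ hEμ, ?_⟩
  · have hexp : m * (δ / 2) ^ 2 / (192 * (2 * K) ^ 4) = s * ℓ * t ^ 2 / (4096 * K ^ 2) := by
      rw [div_pow, hδsq, hL]
      field_simp
      norm_num
    have hbound := grid_card_mul_exp_le (d := min (3 * s) N) hs hsN (min_le_left _ _) hK hℓ₀ hℓ
      (Real.log_le_log hs0 hsm) (by linarith) (by linarith) (by linarith : _ ≤ t)
    rw [hexp]
    have h1 : 2 * Real.exp (-(ℓ₀ / (8192 * K ^ 2)) * t ^ 2)
        ≤ ((m : ℝ) ^ 2 + 2) * Real.exp (-C₂ * t ^ 2) := by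
      gcongr
      · linarith [sq_nonneg (m : ℝ)]
      · exact min_le_right _ _
    linarith
  · intro ω hω x hx e τ T hT k
    obtain ⟨hRIP, hnorm⟩ := hEgood ω hω
    rw [mul_div_cancel₀ δ two_ne_zero] at hRIP
    have hsqrtN : 0 < √(N : ℝ) := Real.sqrt_pos.mpr hN'
    have hsqrtN1 : 1 ≤ √(N : ℝ) := Real.one_le_sqrt.mpr hN1
    have hsqN : √(N : ℝ) ^ 2 = N := Real.sq_sqrt hN'.le
    have hpow : (N : ℝ) ^ (3 / 2 : ℝ) = N * √(N : ℝ) := by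
      rw [show (3 / 2 : ℝ) = 1 + 1 / 2 by norm_num, Real.rpow_add hN', Real.rpow_one,
        Real.sqrt_eq_rpow]
    have hγ0 : 0 ≤ γ := by rw [hγ]; positivity
    have hLsq : 4 ≤ L ^ 2 := by
      calc (4 : ℝ) = 2 ^ 2 := by norm_num
        _ ≤ L ^ 2 := by gcongr
    -- With this `c`, `2 γ √N` is exactly `c / m`.
    have key := (hRIP.of_le_of_card_le le_rfl).norm_kzpt_sub_le (γ := γ) (lam := lam)
      (c := δ / L ^ 2) hm0 hsN hδpos.le hδ4 hγ0 hnorm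
      (by rw [hlam, hγ, hpow]; field_simp)
      (by
        rw [hγ]
        have e : m * (δ / (2 * m * L ^ 2 * √(N : ℝ))) = δ / (2 * L ^ 2 * √(N : ℝ)) := by
          field_simp
        rw [e, div_le_iff₀ (by positivity)]
        have : 4 * 1 ≤ L ^ 2 * √(N : ℝ) := by gcongr
        linarith)
      (by positivity)
      (le_of_eq (by rw [hγ]; field_simp))
      (by
        gcongr
        linarith)
      hT hx e τ k
    refine key.trans (add_le_add le_rfl ?_)
    -- The left side is `√(3 s ℓ / m) / L`, and `L ≥ 2` absorbs `√3`; so `C₀ = 2` is the factor of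
    -- `2 * c`.
    have hc : δ / L ^ 2 ≤ √(s * ℓ / m) := by
      rw [div_le_iff₀ (by positivity)]
      apply le_of_sq_le_sq _ (by positivity)
      rw [mul_pow, Real.sq_sqrt (by positivity), hδsq]
      have e : 3 * s * ℓ * L ^ 2 / m = s * ℓ / m * (3 * L ^ 2) := by ring
      rw [e]
      rw [sq (L ^ 2)]
      gcongr
      linarith
    have hden : 0 < 1 - 4 * δ := by linarith
    gcongr
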